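/- Let $n\in\mathbb N$. Consider the first-order port-Hamiltonian system on $[0,1]$ $$\frac{\partial x}{\partial t}(\zeta,t)=\Big(P_1\frac{\partial}{\partial\zeta}+G_0\Big)\big(\mathcal H(\zeta)x(\zeta,t)\big),\qquad x(\zeta,0)=x_0(\zeta),$$ $$0=W_{B,1}(\mathcal Hx)(1,t)+W_{B,0}(\mathcal Hx)(0,t),\qquad y(t)=W_{C,1}(\mathcal Hx)(1,t)+W_{C,0}(\mathcal Hx)(0,t),\qquad t\ge 0,$$ where $P_1\in\mathbb C^{n\times n}$ is Hermitian and invertible, $G_0\in\mathbb C^{n\times n}$, the $n\times 2n$ matrices $[W_{B,1}\ W_{B,0}]$ and $[W_{C,1}\ W_{C,0}]$ have full row rank, $\mathcal H(\zeta)\in\mathbb C^{n\times n}$ is Hermitian positive definite for almost every $\zeta\in[0,1]$ with $\mathcal H,\mathcal H^{-1}\in L^\infty(0,1;\mathbb C^{n\times n})$, and $P_1\mathcal H(\zeta)=S^{-1}(\zeta)\Delta(\zeta)S(\zeta)$ for almost every $\zeta$, with $\Delta$ diagonal and $S$, $S^{-1}$, $\Delta$ continuously differentiable on $[0,1]$.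 Let $X=L^2(0,1;\mathbb C^n)$ with the energy norm $\|x\|_X^2=\int_0^1 x(\zeta)^*\mathcal H(\zeta)x(\zeta)\,d\zeta$, which is equivalent to the standard norm, and let $$Ax=\Big(P_1\frac{d}{d\zeta}+G_0\Big)(\mathcal Hx),\qquad \mathbf D(A)=\big\{x\in X:\ \mathcal Hx\in H^1(0,1;\mathbb C^n),\ W_{B,1}(\mathcal Hx)(1)+W_{B,0}(\mathcal Hx)(0)=0\big\}.$$ Assume that $A$ generates a $C_0$-semigroup $(T(t))_{t\ge0}$ on $X$ which is strongly stable, that is, $\lim_{t\to\infty}\|T(t)x\|=0$ for every $x\in X$. Assume further that the $2n\times 2n$ matrix $$\mathcal W_{BC}=\begin{bmatrix}W_{B,1}&W_{B,0}\\ W_{C,1}&W_{C,0}\end{bmatrix}$$ is invertible and that $\operatorname{Re}G_0:=\tfrac12(G_0+G_0^*)=0$. Then the system is exactly observable in finite time: there are $t_0>0$ and $\delta>0$ such that for every $x_0\in\mathbf D(A)$ the output $y(t)=W_{C,1}(\mathcal HT(t)x_0)(1)+W_{C,0}(\mathcal HT(t)x_0)(0)$ is square integrable on $(0,t_0)$ and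 $$\int_0^{t_0}\|y(t)\|^2\,dt\ \ge\ \delta\,\|x_0\|_X^2 .$$ -/

import Mathlib

open MeasureTheory Set Filter Topology
open scoped Matrix ENNReal ComplexOrder

noncomputable section

/-! ### `C₀`-semigroups -/

/-- A strongly continuous semigroup `(T(t))_{t ≥ 0}` of bounded operators on a complex normed
space.  Only the values at `t ≥ 0` matter. -/
structure C0Semigroup (X : Type*) [NormedAddCommGroup X] [NormedSpace ℂ X] where
  /-- the operator `T(t)` -/
  op : ℝ → X →L[ℂ] X
  op_zero : op 0 = ContinuousLinearMap.id ℂ X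
  op_add : ∀ s t : ℝ, 0 ≤ s → 0 ≤ t → op (s + t) = (op s).comp (op t)
  tendsto_zero : ∀ x : X, Tendsto (fun t : ℝ => op t x) (𝓝[>] 0) (𝓝 x)

namespace C0Semigroup

variable {X : Type*} [NormedAddCommGroup X] [NormedSpace ℂ X]

/-- `A` is the infinitesimal generator of `T`: `x ∈ D(A)` and `A x = z` if and only if
`(T(t) x - x) / t → z` as `t ↓ 0`. -/
def IsGenerator (T : C0Semigroup X) (A : X →ₗ.[ℂ] X) : Prop :=
  ∀ x z : X, (x, z) ∈ A.graph ↔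
    Tendsto (fun t : ℝ => ((t⁻¹ : ℝ) : ℂ) • (T.op t x - x)) (𝓝[>] 0) (𝓝 z)

/-- Strong stability: `‖T(t) x‖ → 0` as `t → ∞`, for every `x`. -/
def StronglyStable (T : C0Semigroup X) : Prop :=
  ∀ x : X, Tendsto (fun t : ℝ => ‖T.op t x‖) atTop (𝓝 0)

/-- The domain of the generator is invariant under the semigroup. -/
theorem IsGenerator.op_mem_domain {T : C0Semigroup X} {A : X →ₗ.[ℂ] X} (h : T.IsGenerator A)
    {t : ℝ} (ht : 0 ≤ t) {x : X} (hx : x ∈ A.domain) : T.op t x ∈ A.domain := by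
  have h1 := (h x (A ⟨x, hx⟩)).1 (A.mem_graph ⟨x, hx⟩)
  have h2 := ((T.op t).continuous.tendsto _).comp h1
  refine LinearPMap.mem_domain_of_mem_graph ((h (T.op t x) (T.op t (A ⟨x, hx⟩))).2 ?_)
  refine h2.congr' ?_
  filter_upwards [self_mem_nhdsWithin] with s hs
  have e : T.op s (T.op t x) = T.op t (T.op s x) := by
    have e1 := T.op_add s t (le_of_lt hs) ht
    have e2 := T.op_add t s ht (le_of_lt hs)
    rw [add_comm, e2] at e1
    simpa using (congrArg (fun L : X →L[ℂ] X => L x) e1).symm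
  simp [e]

end C0Semigroup

/-! ### Function spaces on the unit interval -/

namespace PortHam

/-- `ℂⁿ` with the Euclidean norm. -/
abbrev Vec (n : ℕ) : Type := EuclideanSpace ℂ (Fin n)

/-- Lebesgue measure on `[0,1]`. -/
abbrev unitMeasure : Measure ℝ := volume.restrict (Icc (0 : ℝ) 1)

/-- `L²(0,1; ℂⁿ)`. -/
abbrev StateSpace (n : ℕ) : Type := Lp (Vec n) 2 unitMeasure

/-- The operator on `ℂⁿ` given by a matrix. -/
abbrev act {n : ℕ} (M : Matrix (Fin n) (Fin n) ℂ) : Vec n →L[ℂ] Vec n :=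
  Matrix.toEuclideanCLM (𝕜 := ℂ) M

/-- `w` is (the continuous representative of) an element of `H¹(0,1; ℂⁿ)` with derivative `g`:
`g` is square integrable and `w` is the absolutely continuous function on `[0,1]` with
`w' = g` almost everywhere. -/
def IsH1 {n : ℕ} (w g : ℝ → Vec n) : Prop :=
  MemLp g 2 unitMeasure ∧ ∀ ζ ∈ Icc (0 : ℝ) 1, w ζ = w 0 + ∫ s in (0 : ℝ)..ζ, g s

theorem MemLp.intervalIntegrable_unit {n : ℕ} {g : ℝ → Vec n} (hg : MemLp g 2 unitMeasure)
    {ζ : ℝ} (hζ : ζ ∈ Icc (0 : ℝ) 1) : IntervalIntegrable g volume 0 ζ := by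
  have h : IntegrableOn g (Icc (0 : ℝ) 1) volume := hg.integrable (by norm_num)
  rw [intervalIntegrable_iff_integrableOn_Icc_of_le hζ.1]
  exact h.mono_set (Icc_subset_Icc_right hζ.2)

theorem IsH1.continuousOn {n : ℕ} {w g : ℝ → Vec n} (h : IsH1 w g) :
    ContinuousOn w (Icc 0 1) := by
  have hu : uIcc (0 : ℝ) 1 = Icc 0 1 := uIcc_of_le (by norm_num)
  have hg : IntegrableOn g (uIcc (0 : ℝ) 1) volume := hu ▸ h.1.integrable (by norm_num)
  have hc := intervalIntegral.continuousOn_primitive_interval hg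
  rw [hu] at hc
  exact (continuousOn_const.add hc).congr h.2

theorem IsH1.add {n : ℕ} {w g w' g' : ℝ → Vec n} (h : IsH1 w g) (h' : IsH1 w' g') :
    IsH1 (w + w') (g + g') := by
  refine ⟨h.1.add h'.1, fun ζ hζ => ?_⟩
  have e := intervalIntegral.integral_add (MemLp.intervalIntegrable_unit h.1 hζ)
    (MemLp.intervalIntegrable_unit h'.1 hζ)
  simp only [Pi.add_apply, e, h.2 ζ hζ, h'.2 ζ hζ]
  abel

theorem IsH1.smul {n : ℕ} {w g : ℝ → Vec n} (c : ℂ) (h : IsH1 w g) :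
    IsH1 (c • w) (c • g) := by
  refine ⟨h.1.const_smul c, fun ζ hζ => ?_⟩
  simp only [Pi.smul_apply, intervalIntegral.integral_smul, h.2 ζ hζ, smul_add]

/-- The continuous representative and the derivative are determined by the `L²` class. -/
theorem IsH1.unique {n : ℕ} {w g w' g' : ℝ → Vec n} (h : IsH1 w g) (h' : IsH1 w' g')
    (hw : w =ᵐ[unitMeasure] w') : EqOn w w' (Icc 0 1) ∧ g =ᵐ[unitMeasure] g' := by
  have hE : EqOn w w' (Icc 0 1) :=
    Measure.eqOn_Icc_of_ae_eq volume (by norm_num) hw h.continuousOn h'.continuousOn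
  refine ⟨hE, ?_⟩
  have h01 : (1 : ℝ) ∈ Icc (0 : ℝ) 1 := by norm_num
  have d := (MemLp.intervalIntegrable_unit h.1 h01).ae_hasDerivAt_integral
  have d' := (MemLp.intervalIntegrable_unit h'.1 h01).ae_hasDerivAt_integral
  have n0 : ∀ᵐ x : ℝ, x ≠ 0 := by simp [ae_iff]
  have n1 : ∀ᵐ x : ℝ, x ≠ 1 := by simp [ae_iff]
  rw [Filter.EventuallyEq, ae_restrict_iff' measurableSet_Icc]
  filter_upwards [d, d', n0, n1] with x hx hx' hx0 hx1 hxI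
  have hu : uIcc (0 : ℝ) 1 = Icc 0 1 := uIcc_of_le (by norm_num)
  rw [hu] at hx hx'
  have a := hx hxI 0 (by norm_num)
  have a' := hx' hxI 0 (by norm_num)
  refine a.unique (a'.congr_of_eventuallyEq ?_)
  have hI : Icc (0 : ℝ) 1 ∈ 𝓝 x :=
    Icc_mem_nhds (lt_of_le_of_ne hxI.1 (Ne.symm hx0)) (lt_of_le_of_ne hxI.2 hx1)
  filter_upwards [hI] with y hy
  have e := hE hy
  rw [h.2 y hy, h'.2 y hy, hE (show (0 : ℝ) ∈ Icc (0 : ℝ) 1 by norm_num)] at e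
  exact add_left_cancel e

end PortHam

/-! ### First order port-Hamiltonian systems -/

open PortHam

/-- The data of the port-Hamiltonian system
`∂x/∂t = (P₁ ∂/∂ζ + G₀)(H x)`, `0 = W_{B,1} (H x)(1) + W_{B,0} (H x)(0)`,
`y = W_{C,1} (H x)(1) + W_{C,0} (H x)(0)` on `[0,1]`, with its structural assumptions. -/
structure PortHamiltonianSystem (n : ℕ) where
  P1 : Matrix (Fin n) (Fin n) ℂ
  G0 : Matrix (Fin n) (Fin n) ℂ
  WB1 : Matrix (Fin n) (Fin n) ℂ
  WB0 : Matrix (Fin n) (Fin n) ℂ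
  WC1 : Matrix (Fin n) (Fin n) ℂ
  WC0 : Matrix (Fin n) (Fin n) ℂ
  /-- the Hamiltonian density -/
  H : ℝ → Matrix (Fin n) (Fin n) ℂ
  P1_hermitian : P1.IsHermitian
  P1_invertible : IsUnit P1
  WB_rank : (Matrix.fromCols WB1 WB0).rank = n
  WC_rank : (Matrix.fromCols WC1 WC0).rank = n
  H_pos : ∀ᵐ ζ ∂unitMeasure, (H ζ).PosDef
  H_bounded : ∀ i j, MemLp (fun ζ => H ζ i j) ∞ unitMeasure
  H_inv_bounded : ∀ i j, MemLp (fun ζ => (H ζ)⁻¹ i j) ∞ unitMeasure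
  /-- `P₁ H = S⁻¹ Δ S` almost everywhere, with `S`, `S⁻¹` and the diagonal matrix `Δ`
  continuously differentiable on `[0,1]`. -/
  diagonalizable : ∃ (S : ℝ → Matrix (Fin n) (Fin n) ℂ) (d : ℝ → Fin n → ℂ),
    (∀ i j, ContDiffOn ℝ 1 (fun ζ => S ζ i j) (Icc 0 1)) ∧
    (∀ i j, ContDiffOn ℝ 1 (fun ζ => (S ζ)⁻¹ i j) (Icc 0 1)) ∧
    (∀ i, ContDiffOn ℝ 1 (fun ζ => d ζ i) (Icc 0 1)) ∧
    ∀ᵐ ζ ∂unitMeasure, IsUnit (S ζ) ∧ P1 * H ζ = (S ζ)⁻¹ * Matrix.diagonal (d ζ) * S ζ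

namespace PortHamiltonianSystem

variable {n : ℕ} (Q : PortHamiltonianSystem n)

/-- The matrix `[[W_{B,1}, W_{B,0}], [W_{C,1}, W_{C,0}]]`. -/
def WBC : Matrix (Fin n ⊕ Fin n) (Fin n ⊕ Fin n) ℂ :=
  Matrix.fromBlocks Q.WB1 Q.WB0 Q.WC1 Q.WC0

/-- The energy norm `‖x‖_X = ⟨x, H x⟩^{1/2}` on `L²(0,1; ℂⁿ)`; it is equivalent to the standard
norm, so that both define the same topology and the same `C₀`-semigroups. -/
def energyNorm (x : StateSpace n) : ℝ :=
  √(∫ ζ, (inner ℂ (x ζ) (act (Q.H ζ) (x ζ))).re ∂unitMeasure)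

/-- `H x` belongs to `H¹(0,1; ℂⁿ)`, with continuous representative `w` and derivative `g`. -/
def IsEffort (x : StateSpace n) (w g : ℝ → Vec n) : Prop :=
  (w =ᵐ[unitMeasure] fun ζ => act (Q.H ζ) (x ζ)) ∧ IsH1 w g

variable {Q}

theorem IsEffort.add {x x' : StateSpace n} {w g w' g' : ℝ → Vec n} (h : Q.IsEffort x w g)
    (h' : Q.IsEffort x' w' g') : Q.IsEffort (x + x') (w + w') (g + g') := by
  refine ⟨?_, h.2.add h'.2⟩
  filter_upwards [h.1, h'.1, Lp.coeFn_add x x'] with ζ h1 h2 h3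
  rw [h3, Pi.add_apply, Pi.add_apply, h1, h2, map_add]

theorem IsEffort.smul {x : StateSpace n} {w g : ℝ → Vec n} (c : ℂ) (h : Q.IsEffort x w g) :
    Q.IsEffort (c • x) (c • w) (c • g) := by
  refine ⟨?_, h.2.smul c⟩
  filter_upwards [h.1, Lp.coeFn_smul c x] with ζ h1 h3
  rw [h3, Pi.smul_apply, Pi.smul_apply, h1, map_smul]

theorem IsEffort.unique {x : StateSpace n} {w g w' g' : ℝ → Vec n} (h : Q.IsEffort x w g)
    (h' : Q.IsEffort x w' g') : EqOn w w' (Icc 0 1) ∧ g =ᵐ[unitMeasure] g' :=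
  h.2.unique h'.2 (h.1.trans h'.1.symm)

theorem isEffort_zero : Q.IsEffort 0 0 0 := by
  refine ⟨?_, MemLp.zero, fun ζ _ => by simp⟩
  filter_upwards [Lp.coeFn_zero (Vec n) 2 unitMeasure] with ζ h
  rw [h]
  simp

variable (Q)

/-- `D(A)`: all `x ∈ X` with `H x ∈ H¹(0,1; ℂⁿ)` and `W_{B,1} (H x)(1) + W_{B,0} (H x)(0) = 0`. -/
def domain : Submodule ℂ (StateSpace n) where
  carrier := {x | ∃ w g, Q.IsEffort x w g ∧ act Q.WB1 (w 1) + act Q.WB0 (w 0) = 0}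
  zero_mem' := ⟨0, 0, isEffort_zero, by simp⟩
  add_mem' := by
    rintro x x' ⟨w, g, h, hb⟩ ⟨w', g', h', hb'⟩
    refine ⟨w + w', g + g', h.add h', ?_⟩
    rw [Pi.add_apply, Pi.add_apply, map_add, map_add, add_add_add_comm, hb, hb', add_zero]
  smul_mem' := by
    rintro c x ⟨w, g, h, hb⟩
    refine ⟨c • w, c • g, h.smul c, ?_⟩
    rw [Pi.smul_apply, Pi.smul_apply, map_smul, map_smul, ← smul_add, hb, smul_zero]

/-- The continuous representative of `H x`, for `x ∈ D(A)`. -/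
def effort (x : Q.domain) : ℝ → Vec n := x.2.choose

/-- The derivative `d/dζ (H x)`, for `x ∈ D(A)`. -/
def effortDeriv (x : Q.domain) : ℝ → Vec n := x.2.choose_spec.choose

theorem isEffort (x : Q.domain) : Q.IsEffort x (Q.effort x) (Q.effortDeriv x) :=
  x.2.choose_spec.choose_spec.1

theorem memLp_A (x : Q.domain) :
    MemLp (fun ζ => act Q.P1 (Q.effortDeriv x ζ) + act Q.G0 (Q.effort x ζ)) 2 unitMeasure := by
  have hx := (Q.isEffort x).2
  have hc := hx.continuousOn
  have hw : MemLp (Q.effort x) 2 unitMeasure := by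
    obtain ⟨C, hC⟩ := isCompact_Icc.exists_bound_of_continuousOn hc
    refine MemLp.of_bound (hc.aestronglyMeasurable measurableSet_Icc) C ?_
    exact (ae_restrict_iff' measurableSet_Icc).2 (Eventually.of_forall hC)
  exact ((act Q.P1).comp_memLp' hx.1).add ((act Q.G0).comp_memLp' hw)

/-- The operator `A x = (P₁ d/dζ + G₀)(H x)` with domain `D(A)`. -/
def A : StateSpace n →ₗ.[ℂ] StateSpace n where
  domain := Q.domain
  toFun :=
    { toFun := fun x => (Q.memLp_A x).toLp _
      map_add' := by
        intro x y
        rw [← MemLp.toLp_add]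
        refine MemLp.toLp_congr _ _ ?_
        obtain ⟨h1, h2⟩ := (Q.isEffort (x + y)).unique ((Q.isEffort x).add (Q.isEffort y))
        filter_upwards [h2, ae_restrict_mem measurableSet_Icc] with ζ h3 h4
        simp only [h1 h4, h3, Pi.add_apply, map_add]
        abel
      map_smul' := by
        intro c x
        rw [RingHom.id_apply, ← MemLp.toLp_const_smul]
        refine MemLp.toLp_congr _ _ ?_
        obtain ⟨h1, h2⟩ := (Q.isEffort (c • x)).unique ((Q.isEffort x).smul c)
        filter_upwards [h2, ae_restrict_mem measurableSet_Icc] with ζ h3 h4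
        simp only [h1 h4, h3, Pi.smul_apply, map_smul, smul_add] }

open scoped Classical in
/-- The boundary output `C x = W_{C,1} (H x)(1) + W_{C,0} (H x)(0)` for `x ∈ D(A)` (extended by
zero to all of `X`; it is only evaluated on `D(A)`). -/
def output (x : StateSpace n) : Vec n :=
  if hx : x ∈ Q.domain then act Q.WC1 (Q.effort ⟨x, hx⟩ 1) + act Q.WC0 (Q.effort ⟨x, hx⟩ 0)
  else 0

/-- The system whose operator `A` generates `T` is exactly observable in finite time: the output
`y(t) = C T(t) x₀` satisfies `∫₀^{t₀} ‖y(t)‖² dt ≥ δ ‖x₀‖²` on `D(A)`, in the norm of `X`. -/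
def ExactlyObservableInFiniteTime (T : C0Semigroup (StateSpace n)) : Prop :=
  ∃ t₀ > (0 : ℝ), ∃ δ > (0 : ℝ), ∀ x₀ ∈ Q.A.domain,
    IntervalIntegrable (fun t => ‖Q.output (T.op t x₀)‖ ^ 2) volume 0 t₀ ∧
    δ * Q.energyNorm x₀ ^ 2 ≤ ∫ t in (0 : ℝ)..t₀, ‖Q.output (T.op t x₀)‖ ^ 2

end PortHamiltonianSystem

end

/-!
The system exchanges energy through the boundary only, and a multiplier argument shows that it is
exactly observable from its full boundary trace.

Let `x(t) = T(t) x₀` be a classical solution with effort `w = H x`, let `E = ∫ x^* H x` be its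
energy and write `K = H⁻¹`, so that `x = K w`. Both `H` and `K` have continuously differentiable
representatives, because `P₁ H` is diagonalized by continuously differentiable matrices and has an
essentially bounded inverse (`exists_contDiffOn_hamiltonian`).

* As `Re G₀ = 0`, the energy satisfies `E' = w(1)^* P₁ w(1) - w(0)^* P₁ w(0)` (`energy_balance`).
* For the functional `Ψ = ∫ m x^* P₁⁻¹ x` with the weight `m = e^{κζ}` one finds
  `Ψ' = ∫ m (2 Re x^* w_ζ + 2 Re (P₁⁻¹ x)^* G₀ w)`, and
  `2 Re x^* w_ζ = (w^* K w)_ζ - w^* K_ζ w`. After an integration by parts, a large `κ` makes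
  `-∫ m_ζ w^* K w` absorb all terms of order zero, and
  `Ψ' ≤ C (|w(1)|² + |w(0)|²) - E` remains (`exists_multiplier`).
* Since `W_BC` is invertible and the boundary condition holds, `|w(1)|² + |w(0)|² ≤ c |y|²`
  (`exists_boundary_le_output`).

Hence `E` varies on `[0,τ]` by at most a multiple of `∫ |y|²`, while integrating the estimate for
`Ψ` gives `∫ E ≤ C ∫ |y|² + |Ψ(0)| + |Ψ(τ)|`. As `|Ψ| ≤ c₃ E`, this bounds `(τ - 2 c₃) E(0)` by a
multiple of `∫ |y|²` (`initial_energy_le_integral`), and it suffices to take `τ > 2 c₃`.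

All of this takes place on the domain of the generator, where orbits are right differentiable
(`hasDerivWithinAt_orbit`), the output is continuous in time (`continuousOn_output`, by way of
`exists_trace`), and efforts are absolutely continuous in space, with the product rule
`IsPrimitive.bilin`.
-/

/-! ### Absolutely continuous functions on the unit interval -/

namespace PortHam

/-- `f` is absolutely continuous on `[0,1]` with (almost everywhere) derivative `f'`, expressed by
the fundamental theorem of calculus. -/
structure IsPrimitive {E : Type*} [NormedAddCommGroup E] [NormedSpace ℝ E] (f f' : ℝ → E) :
    Prop where
  integrableOn : IntegrableOn f' (Icc 0 1)
  eq_add_integral : ∀ ζ ∈ Icc (0 : ℝ) 1, f ζ = f 0 + ∫ s in (0 : ℝ)..ζ, f' s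

section Bilinear

variable {E F G : Type*} [NormedAddCommGroup E] [NormedSpace ℝ E]
  [NormedAddCommGroup F] [NormedSpace ℝ F] [NormedAddCommGroup G] [NormedSpace ℝ G]

theorem IsPrimitive.intervalIntegrable {f f' : ℝ → E} (h : IsPrimitive f f') {ζ : ℝ}
    (hζ : ζ ∈ Icc (0 : ℝ) 1) : IntervalIntegrable f' volume 0 ζ := by
  rw [intervalIntegrable_iff_integrableOn_Icc_of_le hζ.1]
  exact h.integrableOn.mono_set (Icc_subset_Icc_right hζ.2)

theorem IsPrimitive.continuousOn {f f' : ℝ → E} (h : IsPrimitive f f') :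
    ContinuousOn f (Icc 0 1) := by
  have hu : uIcc (0 : ℝ) 1 = Icc 0 1 := uIcc_of_le (by norm_num)
  have hc := intervalIntegral.continuousOn_primitive_interval (hu ▸ h.integrableOn)
  rw [hu] at hc
  exact (continuousOn_const.add hc).congr h.eq_add_integral

theorem integrableOn_bilin_left (B : E →L[ℝ] F →L[ℝ] G) {f : ℝ → E} {g : ℝ → F}
    (hf : ContinuousOn f (Icc 0 1)) (hg : IntegrableOn g (Icc (0 : ℝ) 1)) :
    IntegrableOn (fun ζ => B (f ζ) (g ζ)) (Icc (0 : ℝ) 1) := by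
  obtain ⟨C, hC⟩ := isCompact_Icc.exists_bound_of_continuousOn hf
  exact B.integrable_of_bilin_of_bdd_left C (hf.aestronglyMeasurable measurableSet_Icc)
    ((ae_restrict_iff' measurableSet_Icc).2 (Eventually.of_forall hC)) hg

variable [CompleteSpace E]

theorem IsPrimitive.of_contDiffOn {f : ℝ → E} (hf : ContDiffOn ℝ 1 f (Icc 0 1)) :
    IsPrimitive f (derivWithin f (Icc 0 1)) := by
  have hc : ContinuousOn (derivWithin f (Icc (0 : ℝ) 1)) (Icc 0 1) :=
    hf.continuousOn_derivWithin (uniqueDiffOn_Icc (by norm_num)) le_rfl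
  refine ⟨hc.integrableOn_Icc, fun ζ hζ => ?_⟩
  have hsub : Icc 0 ζ ⊆ Icc (0 : ℝ) 1 := Icc_subset_Icc_right hζ.2
  rw [intervalIntegral.integral_eq_sub_of_hasDerivAt_of_le hζ.1 (hf.continuousOn.mono hsub)]
  · abel
  · intro s hs
    have hI : Icc (0 : ℝ) 1 ∈ 𝓝 s := Icc_mem_nhds hs.1 (hs.2.trans_le hζ.2)
    exact (hf.differentiableOn one_ne_zero s (hsub (Ioo_subset_Icc_self hs))).hasDerivWithinAt
      |>.hasDerivAt hI
  · exact ContinuousOn.intervalIntegrable_of_Icc hζ.1 (hc.mono hsub)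

variable [CompleteSpace F] [CompleteSpace G]

/-- Integration by parts for the primitives of two integrable functions, by Fubini's theorem on
the two triangles of the square `(0,x]²`. -/
theorem bilin_integral_integral (B : E →L[ℝ] F →L[ℝ] G) {φ : ℝ → E} {γ : ℝ → F} {x : ℝ}
    (hx : 0 ≤ x) (hφ : IntegrableOn φ (Ioc 0 x)) (hγ : IntegrableOn γ (Ioc 0 x)) :
    B (∫ s in (0 : ℝ)..x, φ s) (∫ t in (0 : ℝ)..x, γ t) =
      (∫ s in (0 : ℝ)..x, B (φ s) (∫ t in (0 : ℝ)..s, γ t)) +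
        ∫ t in (0 : ℝ)..x, B (∫ s in (0 : ℝ)..t, φ s) (γ t) := by
  set μ : Measure ℝ := volume.restrict (Ioc 0 x) with hμ
  have hk : Integrable (fun z : ℝ × ℝ => B (φ z.1) (γ z.2)) (μ.prod μ) :=
    Integrable.op_fst_snd (op := fun a b => B a b) (by fun_prop) ⟨‖B‖, B.le_opNorm₂⟩ hφ hγ
  have hD : MeasurableSet {z : ℝ × ℝ | z.2 ≤ z.1} :=
    measurableSet_le measurable_snd measurable_fst
  have e := integral_prod_bilin B (μ := μ) (ν := μ) hφ hγ
  rw [intervalIntegral.integral_of_le hx, intervalIntegral.integral_of_le hx,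
    intervalIntegral.integral_of_le hx, intervalIntegral.integral_of_le hx, ← e,
    ← integral_add_compl hD hk, ← integral_indicator hD, ← integral_indicator hD.compl,
    integral_prod _ (hk.indicator hD), integral_prod_symm _ (hk.indicator hD.compl)]
  congr 1
  · refine setIntegral_congr_fun measurableSet_Ioc fun s hs => ?_
    have e1 : (fun t => {z : ℝ × ℝ | z.2 ≤ z.1}.indicator
        (fun z : ℝ × ℝ => B (φ z.1) (γ z.2)) (s, t)) =
        (Iic s).indicator fun t => B (φ s) (γ t) := by
      ext t
      simp [indicator]
    have e2 : Iic s ∩ Ioc 0 x = Ioc 0 s := by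
      ext t
      simp only [mem_inter_iff, mem_Iic, mem_Ioc]
      exact ⟨fun h => ⟨h.2.1, h.1⟩, fun h => ⟨h.2, h.1, h.2.trans hs.2⟩⟩
    rw [e1, integral_indicator measurableSet_Iic, hμ, Measure.restrict_restrict measurableSet_Iic,
      e2, intervalIntegral.integral_of_le hs.1.le]
    exact (B (φ s)).integral_comp_comm (hγ.mono_set (Ioc_subset_Ioc_right hs.2))
  · refine setIntegral_congr_fun measurableSet_Ioc fun t ht => ?_
    have e1 : (fun s => {z : ℝ × ℝ | z.2 ≤ z.1}ᶜ.indicator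
        (fun z : ℝ × ℝ => B (φ z.1) (γ z.2)) (s, t)) =
        (Iio t).indicator fun s => B.flip (γ t) (φ s) := by
      ext s
      simp [indicator]
    have e2 : Iio t ∩ Ioc 0 x = Ioo 0 t := by
      ext s
      simp only [mem_inter_iff, mem_Iio, mem_Ioc, mem_Ioo]
      exact ⟨fun h => ⟨h.2.1, h.1⟩, fun h => ⟨h.2, h.1, h.2.le.trans ht.2⟩⟩
    rw [e1, integral_indicator measurableSet_Iio, hμ, Measure.restrict_restrict measurableSet_Iio,
      e2, intervalIntegral.integral_of_le ht.1.le, ← integral_Ioc_eq_integral_Ioo]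
    exact (B.flip (γ t)).integral_comp_comm (hφ.mono_set (Ioc_subset_Ioc_right ht.2))

/-- The product rule for absolutely continuous functions. -/
theorem IsPrimitive.bilin (B : E →L[ℝ] F →L[ℝ] G) {f f' : ℝ → E} {g g' : ℝ → F}
    (hf : IsPrimitive f f') (hg : IsPrimitive g g') :
    IsPrimitive (fun ζ => B (f ζ) (g ζ)) (fun ζ => B (f' ζ) (g ζ) + B (f ζ) (g' ζ)) := by
  have h1 := integrableOn_bilin_left B.flip hg.continuousOn hf.integrableOn
  have h2 := integrableOn_bilin_left B hf.continuousOn hg.integrableOn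
  refine ⟨h1.add h2, fun ζ hζ => ?_⟩
  have hsub : Ioc 0 ζ ⊆ Icc (0 : ℝ) 1 := Ioc_subset_Icc_self.trans (Icc_subset_Icc_right hζ.2)
  have key := bilin_integral_integral B hζ.1 (hf.integrableOn.mono_set hsub)
    (hg.integrableOn.mono_set hsub)
  have i1 := hf.intervalIntegrable hζ
  have i2 := hg.intervalIntegrable hζ
  have ii {k : ℝ → G} (hk : IntegrableOn k (Icc 0 1)) : IntervalIntegrable k volume 0 ζ := by
    rw [intervalIntegrable_iff_integrableOn_Ioc_of_le hζ.1]
    exact hk.mono_set hsub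
  have hu : uIcc (0 : ℝ) 1 = Icc 0 1 := uIcc_of_le (by norm_num)
  have cf := intervalIntegral.continuousOn_primitive_interval (hu ▸ hf.integrableOn)
  have cg := intervalIntegral.continuousOn_primitive_interval (hu ▸ hg.integrableOn)
  rw [hu] at cf cg
  have j1 := ii (integrableOn_bilin_left B.flip cg hf.integrableOn)
  have j2 := ii (integrableOn_bilin_left B cf hg.integrableOn)
  have c1 := (B.flip (g 0)).intervalIntegral_comp_comm i1
  have c2 := (B (f 0)).intervalIntegral_comp_comm i2
  have e1 : ∫ s in (0 : ℝ)..ζ, B (f' s) (g s) + B (f s) (g' s) =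
      ∫ s in (0 : ℝ)..ζ, (B.flip (g 0) (f' s) + B (f' s) (∫ t in (0 : ℝ)..s, g' t)) +
        (B (f 0) (g' s) + B (∫ t in (0 : ℝ)..s, f' t) (g' s)) := by
    refine intervalIntegral.integral_congr fun s hs => ?_
    rw [uIcc_of_le hζ.1] at hs
    have hs' : s ∈ Icc (0 : ℝ) 1 := Icc_subset_Icc_right hζ.2 hs
    rw [hf.eq_add_integral s hs', hg.eq_add_integral s hs']
    simp
  have k1 : IntervalIntegrable (fun s => B.flip (g 0) (f' s)) volume 0 ζ :=
    ii ((B.flip (g 0)).integrable_comp hf.integrableOn)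
  have k2 : IntervalIntegrable (fun s => B (f 0) (g' s)) volume 0 ζ :=
    ii ((B (f 0)).integrable_comp hg.integrableOn)
  simp only [ContinuousLinearMap.flip_apply] at j1 j2
  rw [e1, intervalIntegral.integral_add (k1.add j1) (k2.add j2),
    intervalIntegral.integral_add k1 j1, intervalIntegral.integral_add k2 j2, c1, c2,
    hf.eq_add_integral ζ hζ, hg.eq_add_integral ζ hζ]
  simp only [map_add, add_apply, key, ContinuousLinearMap.flip_apply]
  abel

end Bilinear

theorem IsH1.isPrimitive {n : ℕ} {w g : ℝ → Vec n} (h : IsH1 w g) : IsPrimitive w g :=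
  ⟨h.1.integrable (by norm_num), h.2⟩

end PortHam

/-! ### Orbits of a `C₀`-semigroup -/

namespace C0Semigroup

variable {X : Type*} [NormedAddCommGroup X] [NormedSpace ℂ X] (T : C0Semigroup X)

theorem op_add_apply {s t : ℝ} (hs : 0 ≤ s) (ht : 0 ≤ t) (x : X) :
    T.op (s + t) x = T.op s (T.op t x) := by
  rw [T.op_add s t hs ht]; rfl

theorem exists_bound_near_zero [CompleteSpace X] :
    ∃ δ > 0, ∃ C, ∀ t ∈ Icc (0 : ℝ) δ, ‖T.op t‖ ≤ C := by
  by_contra! h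
  -- otherwise `T` is unbounded along a null sequence, against the uniform boundedness principle
  have hpos (k : ℕ) : (0 : ℝ) < 1 / (k + 1) := Nat.one_div_pos_of_nat
  choose u hu hu' using fun k : ℕ => h (1 / ((k : ℝ) + 1)) (hpos k) (k : ℝ)
  have hu0 : Tendsto u atTop (𝓝 0) :=
    squeeze_zero (fun k => (hu k).1) (fun k => (hu k).2) tendsto_one_div_add_atTop_nhds_zero_nat
  have hcont (x : X) : Tendsto (fun t => T.op t x) (𝓝[≥] 0) (𝓝 x) := by
    have h0 : Tendsto (fun t => T.op t x) (pure 0) (𝓝 x) := by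
      have : T.op 0 x = x := by rw [T.op_zero]; rfl
      rw [tendsto_pure_left]
      intro s hs
      rw [this]
      exact mem_of_mem_nhds hs
    have : (𝓝[≥] (0 : ℝ)) = 𝓝[>] 0 ⊔ pure 0 := by
      rw [← Ioi_insert, nhdsWithin_insert, sup_comm]
    rw [this]
    exact (T.tendsto_zero x).sup h0
  have hx (x : X) : ∃ C, ∀ k, ‖T.op (u k) x‖ ≤ C := by
    have : Tendsto (fun k => T.op (u k) x) atTop (𝓝 x) :=
      (hcont x).comp (tendsto_nhdsWithin_iff.2 ⟨hu0, Eventually.of_forall fun k => (hu k).1⟩)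
    obtain ⟨C, hC⟩ := (Metric.isBounded_range_of_tendsto _ this).exists_norm_le
    exact ⟨C, fun k => hC _ ⟨k, rfl⟩⟩
  obtain ⟨C, hC⟩ := banach_steinhaus hx
  obtain ⟨k, hk⟩ := exists_nat_gt C
  exact absurd (hC k) (not_le.2 (hk.trans (hu' k)))

theorem exists_bound [CompleteSpace X] (τ : ℝ) :
    ∃ C, ∀ t ∈ Icc (0 : ℝ) τ, ‖T.op t‖ ≤ C := by
  obtain ⟨δ, hδ, C, hC⟩ := T.exists_bound_near_zero
  have key : ∀ k : ℕ, ∃ D, ∀ t ∈ Icc (0 : ℝ) (k * δ), ‖T.op t‖ ≤ D := by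
    intro k
    induction k with
    | zero =>
      refine ⟨‖T.op 0‖, fun t ht => ?_⟩
      have : t = 0 := le_antisymm (by simpa using ht.2) ht.1
      rw [this]
    | succ k ih =>
      obtain ⟨D, hD⟩ := ih
      refine ⟨max C (C * D), fun t ht => ?_⟩
      rcases le_total t δ with h | h
      · exact (hC t ⟨ht.1, h⟩).trans (le_max_left _ _)
      · have ht' : t - δ ∈ Icc (0 : ℝ) (k * δ) := by
          refine ⟨sub_nonneg.2 h, ?_⟩
          have := ht.2
          push_cast at this
          linarith
        have e := T.op_add δ (t - δ) hδ.le ht'.1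
        rw [add_sub_cancel] at e
        rw [e]
        have hC0 : 0 ≤ C := (norm_nonneg _).trans (hC δ ⟨hδ.le, le_rfl⟩)
        exact ((ContinuousLinearMap.opNorm_comp_le _ _).trans
          (mul_le_mul (hC δ ⟨hδ.le, le_rfl⟩) (hD _ ht') (norm_nonneg _) hC0)).trans
          (le_max_right _ _)
  obtain ⟨k, hk⟩ := exists_nat_gt (τ / δ)
  obtain ⟨D, hD⟩ := key k
  exact ⟨D, fun t ht => hD t ⟨ht.1, ht.2.trans ((div_lt_iff₀ hδ).1 hk).le⟩⟩

/-- Orbits are continuous on `[0,∞)`. -/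
theorem continuousOn_orbit [CompleteSpace X] (x : X) :
    ContinuousOn (fun t => T.op t x) (Ici 0) := by
  intro t ht
  obtain ⟨C, hC⟩ := T.exists_bound (t + 1)
  have hC0 : 0 ≤ C := (norm_nonneg _).trans (hC 0 ⟨le_rfl, by have : (0 : ℝ) ≤ t := ht; linarith⟩)
  rw [Metric.continuousWithinAt_iff]
  intro ε hε
  have h0 := T.tendsto_zero x
  rw [Metric.tendsto_nhdsWithin_nhds] at h0
  obtain ⟨δ, hδ, h⟩ := h0 (ε / (C + 1)) (by positivity)
  -- `‖T(b)x - T(a)x‖ ≤ ‖T(a)‖ ‖T(b - a)x - x‖` covers both one-sided limits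
  have key : ∀ a b : ℝ, 0 ≤ a → a < b → a ≤ t + 1 → b - a < δ →
      dist (T.op b x) (T.op a x) < ε := by
    intro a b ha hab hat hd
    have e : T.op b x = T.op a (T.op (b - a) x) := by
      rw [← T.op_add_apply ha (sub_pos.2 hab).le, add_sub_cancel]
    have h1 := h (sub_pos.2 hab) (by rwa [Real.dist_eq, sub_zero, abs_of_pos (sub_pos.2 hab)])
    rw [dist_eq_norm] at h1
    rw [dist_eq_norm, e, ← map_sub]
    calc ‖T.op a (T.op (b - a) x - x)‖ ≤ C * ‖T.op (b - a) x - x‖ :=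
          (T.op a).le_of_opNorm_le (hC a ⟨ha, hat⟩) _
      _ ≤ (C + 1) * ‖T.op (b - a) x - x‖ := by gcongr; linarith
      _ < (C + 1) * (ε / (C + 1)) := by gcongr
      _ = ε := by field_simp
  refine ⟨min δ 1, by positivity, fun s hs hd => ?_⟩
  rw [Real.dist_eq, lt_min_iff] at hd
  rcases lt_trichotomy s t with hst | hst | hst
  · rw [dist_comm]
    refine key s t hs hst (by linarith) ?_
    rw [abs_sub_comm, abs_of_pos (sub_pos.2 hst)] at hd
    exact hd.1
  · rw [hst, dist_self]; exact hε
  · refine key t s ht hst (by linarith) ?_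
    rw [abs_of_pos (sub_pos.2 hst)] at hd
    exact hd.1

/-- The generator commutes with the semigroup on its domain. -/
theorem IsGenerator.apply_op {T : C0Semigroup X} {A : X →ₗ.[ℂ] X} (h : T.IsGenerator A)
    {t : ℝ} (ht : 0 ≤ t) (x : A.domain) :
    A ⟨T.op t x, h.op_mem_domain ht x.2⟩ = T.op t (A x) := by
  have h1 := (h x (A x)).1 (A.mem_graph x)
  have h2 := ((T.op t).continuous.tendsto _).comp h1
  have h3 := (h _ _).1 (A.mem_graph ⟨T.op t x, h.op_mem_domain ht x.2⟩)
  refine tendsto_nhds_unique h3 (h2.congr' ?_)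
  filter_upwards [self_mem_nhdsWithin] with s hs
  have e : T.op s (T.op t x) = T.op t (T.op s x) := by
    rw [← T.op_add_apply (le_of_lt hs) ht, ← T.op_add_apply ht (le_of_lt hs), add_comm]
  simp [e]

/-- Orbits starting in the domain solve `x' = A x`, in the sense of right derivatives. -/
theorem IsGenerator.hasDerivWithinAt_orbit [NormedSpace ℝ X] [IsScalarTower ℝ ℂ X]
    {T : C0Semigroup X} {A : X →ₗ.[ℂ] X} (h : T.IsGenerator A)
    {t : ℝ} (ht : 0 ≤ t) (x : A.domain) :
    HasDerivWithinAt (fun s => T.op s x) (T.op t (A x)) (Ioi t) t := by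
  have h3 := (h _ _).1 (A.mem_graph ⟨T.op t x, h.op_mem_domain ht x.2⟩)
  rw [h.apply_op ht x] at h3
  rw [hasDerivWithinAt_iff_tendsto_slope' self_notMem_Ioi]
  have h4 : Tendsto (fun s : ℝ => s - t) (𝓝[>] t) (𝓝[>] 0) := by
    refine tendsto_nhdsWithin_iff.2 ⟨?_, ?_⟩
    · have : Tendsto (fun s : ℝ => s - t) (𝓝 t) (𝓝 (t - t)) := tendsto_id.sub_const t
      rw [sub_self] at this
      exact this.mono_left nhdsWithin_le_nhds
    · filter_upwards [self_mem_nhdsWithin] with s hs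
      exact sub_pos.2 (mem_Ioi.1 hs)
  refine (h3.comp h4).congr' ?_
  filter_upwards [self_mem_nhdsWithin] with s hs
  have e : T.op s x = T.op (s - t) (T.op t x) := by
    rw [← T.op_add_apply (sub_nonneg.2 (le_of_lt hs)) ht, sub_add_cancel]
  simp only [Function.comp_apply, slope, vsub_eq_sub, ← e]
  rw [← Complex.coe_algebraMap, algebraMap_smul]

end C0Semigroup

/-! ### Matrix-valued functions on the unit interval -/

namespace PortHam

variable {n : ℕ}

theorem act_mul_apply (M N : Matrix (Fin n) (Fin n) ℂ) (v : Vec n) :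
    act (M * N) v = act M (act N v) := by
  simp only [act, map_mul]
  rfl

theorem act_one_apply (v : Vec n) : act (1 : Matrix (Fin n) (Fin n) ℂ) v = v := by
  simp only [act, map_one]
  rfl

theorem inner_act_left (M : Matrix (Fin n) (Fin n) ℂ) (u v : Vec n) :
    inner ℂ (act M u) v = inner ℂ u (act Mᴴ v) := by
  have : act Mᴴ = ContinuousLinearMap.adjoint (act M) := by
    rw [← ContinuousLinearMap.star_eq_adjoint, act, act, ← map_star, Matrix.star_eq_conjTranspose]
  rw [this, ContinuousLinearMap.adjoint_inner_right]

theorem re_inner_act_nonneg {M : Matrix (Fin n) (Fin n) ℂ} (hM : M.PosSemidef) (v : Vec n) :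
    0 ≤ (inner ℂ v (act M v)).re := by
  rw [EuclideanSpace.inner_eq_star_dotProduct, dotProduct_comm]
  exact (Complex.le_def.1 (hM.dotProduct_mulVec_nonneg v.ofLp)).1

theorem contDiffOn_act {M : ℝ → Matrix (Fin n) (Fin n) ℂ}
    (hM : ∀ i j, ContDiffOn ℝ 1 (fun ζ => M ζ i j) (Icc 0 1)) :
    ContDiffOn ℝ 1 (fun ζ => act (M ζ)) (Icc 0 1) := by
  let L : (Fin n → Fin n → ℂ) →ₗ[ℝ] (Vec n →L[ℂ] Vec n) :=
    { toFun := fun A => act (Matrix.of A)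
      map_add' := fun A B => map_add Matrix.toEuclideanCLM (Matrix.of A) (Matrix.of B)
      map_smul' := fun c A => by
        have := map_smul (Matrix.toEuclideanCLM (𝕜 := ℂ) (n := Fin n)) (c : ℂ) (Matrix.of A)
        simpa using this }
  have h : ContDiffOn ℝ 1 (fun ζ => (fun i j => M ζ i j : Fin n → Fin n → ℂ)) (Icc 0 1) :=
    contDiffOn_pi.2 fun i => contDiffOn_pi.2 fun j => hM i j
  exact (LinearMap.toContinuousLinearMap L).contDiff.comp_contDiffOn h

theorem contDiffOn_matrix_mul {M N : ℝ → Matrix (Fin n) (Fin n) ℂ}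
    (hM : ∀ i j, ContDiffOn ℝ 1 (fun ζ => M ζ i j) (Icc 0 1))
    (hN : ∀ i j, ContDiffOn ℝ 1 (fun ζ => N ζ i j) (Icc 0 1)) (i j : Fin n) :
    ContDiffOn ℝ 1 (fun ζ => (M ζ * N ζ) i j) (Icc 0 1) := by
  simp only [Matrix.mul_apply]
  exact ContDiffOn.sum fun k _ => (hM i k).mul (hN k j)

theorem contDiffOn_matrix_diagonal {d : ℝ → Fin n → ℂ}
    (hd : ∀ i, ContDiffOn ℝ 1 (fun ζ => d ζ i) (Icc 0 1)) (i j : Fin n) :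
    ContDiffOn ℝ 1 (fun ζ => Matrix.diagonal (d ζ) i j) (Icc 0 1) := by
  by_cases h : i = j
  · subst h
    simpa using hd i
  · simpa [Matrix.diagonal_apply_ne _ h] using contDiffOn_const

theorem memLp_top_of_continuousOn {E : Type*} [NormedAddCommGroup E] {f : ℝ → E}
    (hf : ContinuousOn f (Icc 0 1)) : MemLp f ∞ unitMeasure := by
  obtain ⟨C, hC⟩ := isCompact_Icc.exists_bound_of_continuousOn hf
  exact memLp_top_of_bound
    (hf.aestronglyMeasurable_of_isCompact isCompact_Icc measurableSet_Icc) C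
    ((ae_restrict_iff' measurableSet_Icc).2 (Eventually.of_forall hC))

theorem memLp_top_matrix_mul {M N : ℝ → Matrix (Fin n) (Fin n) ℂ}
    (hM : ∀ i j, MemLp (fun ζ => M ζ i j) ∞ unitMeasure)
    (hN : ∀ i j, MemLp (fun ζ => N ζ i j) ∞ unitMeasure) (i j : Fin n) :
    MemLp (fun ζ => (M ζ * N ζ) i j) ∞ unitMeasure := by
  simp only [Matrix.mul_apply]
  exact memLp_finsetSum _ fun k _ => (hN k j).mul (hM i k)

/-- An almost everywhere lower bound for a continuous function holds everywhere. -/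
theorem le_of_ae_le_of_continuousOn {f : ℝ → ℝ} {c : ℝ} (hf : ContinuousOn f (Icc 0 1))
    (h : ∀ᵐ ζ ∂unitMeasure, c ≤ f ζ) : ∀ ζ ∈ Icc (0 : ℝ) 1, c ≤ f ζ := by
  have e : f =ᵐ[unitMeasure] fun ζ => max c (f ζ) := by
    filter_upwards [h] with ζ hζ
    rw [max_eq_right hζ]
  have := Measure.eqOn_Icc_of_ae_eq volume (by norm_num) e hf (continuousOn_const.sup hf)
  exact fun ζ hζ => (this hζ).symm ▸ le_max_left _ _

/-- Pointwise multiplication on `L²(0,1; ℂⁿ)` by a continuous operator-valued function. -/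
noncomputable def mulOp (M : ℝ → Vec n →L[ℂ] Vec n) (hM : ContinuousOn M (Icc 0 1)) :
    StateSpace n →L[ℂ] StateSpace n :=
  (ContinuousLinearMap.id ℂ (Vec n →L[ℂ] Vec n)).holderL unitMeasure ∞ 2 2
    ((memLp_top_of_continuousOn hM).toLp M)

theorem coeFn_mulOp (M : ℝ → Vec n →L[ℂ] Vec n) (hM : ContinuousOn M (Icc 0 1))
    (x : StateSpace n) : mulOp M hM x =ᵐ[unitMeasure] fun ζ => M ζ (x ζ) := by
  have h := (ContinuousLinearMap.id ℂ (Vec n →L[ℂ] Vec n)).coeFn_holder (r := 2)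
    ((memLp_top_of_continuousOn hM).toLp M) x
  filter_upwards [h, (memLp_top_of_continuousOn hM).coeFn_toLp] with ζ h1 h2
  rw [h2] at h1
  exact h1

theorem mulOp_inner_left {M : ℝ → Vec n →L[ℂ] Vec n} (hM : ContinuousOn M (Icc 0 1))
    (hs : ∀ᵐ ζ ∂unitMeasure, ∀ u v, inner ℂ (M ζ u) v = inner ℂ u (M ζ v))
    (x y : StateSpace n) : inner ℂ (mulOp M hM x) y = inner ℂ x (mulOp M hM y) := by
  rw [L2.inner_def, L2.inner_def]
  refine integral_congr_ae ?_
  filter_upwards [hs, coeFn_mulOp M hM x, coeFn_mulOp M hM y] with ζ h h1 h2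
  rw [h1, h2, h]

/-- The mean value as a bounded operator on `L²(0,1; ℂⁿ)`. -/
noncomputable def meanL : StateSpace n →L[ℂ] Vec n :=
  (ContinuousLinearMap.lsmul ℂ ℂ).lpPairing unitMeasure 2 2
    ((memLp_const (1 : ℂ)).toLp (fun _ => (1 : ℂ)))

theorem meanL_apply (x : StateSpace n) : meanL x = ∫ ζ in (0 : ℝ)..1, x ζ := by
  rw [meanL, ContinuousLinearMap.lpPairing_eq_integral, intervalIntegral.integral_of_le zero_le_one,
    ← integral_Icc_eq_integral_Ioc]
  refine integral_congr_ae ?_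
  filter_upwards [(memLp_const (1 : ℂ) : MemLp _ 2 unitMeasure).coeFn_toLp] with ζ h
  rw [h]
  simp

end PortHam

/-! ### Regularity of the Hamiltonian density -/

namespace PortHamiltonianSystem

open PortHam

variable {n : ℕ} (Q : PortHamiltonianSystem n)

/-- Since `P₁ H = S⁻¹ Δ S` with continuously differentiable factors, both `H` and `H⁻¹` agree
almost everywhere with continuously differentiable functions. For `H⁻¹` this uses that `Δ`, being
continuous with essentially bounded inverse, is invertible at every point. -/
theorem exists_contDiffOn_hamiltonian : ∃ M N : ℝ → Matrix (Fin n) (Fin n) ℂ,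
    (∀ i j, ContDiffOn ℝ 1 (fun ζ => M ζ i j) (Icc 0 1)) ∧
    (∀ i j, ContDiffOn ℝ 1 (fun ζ => N ζ i j) (Icc 0 1)) ∧
    (∀ᵐ ζ ∂unitMeasure, Q.H ζ = M ζ) ∧ (∀ᵐ ζ ∂unitMeasure, (Q.H ζ)⁻¹ = N ζ) := by
  obtain ⟨S, d, hS, hS', hd, hdiag⟩ := Q.diagonalizable
  have hP1 : IsUnit Q.P1.det := (Matrix.isUnit_iff_isUnit_det _).1 Q.P1_invertible
  have hc (A : Matrix (Fin n) (Fin n) ℂ) (i j : Fin n) :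
      ContDiffOn ℝ 1 (fun _ : ℝ => A i j) (Icc 0 1) := contDiffOn_const
  have hcd {A : ℝ → Matrix (Fin n) (Fin n) ℂ}
      (hA : ∀ i j, ContDiffOn ℝ 1 (fun ζ => A ζ i j) (Icc 0 1)) (i j : Fin n) :
      MemLp (fun ζ => A ζ i j) ∞ unitMeasure := memLp_top_of_continuousOn (hA i j).continuousOn
  have hH : ∀ᵐ ζ ∂unitMeasure, IsUnit (S ζ).det ∧ IsUnit (Q.H ζ).det ∧
      Q.H ζ = Q.P1⁻¹ * ((S ζ)⁻¹ * Matrix.diagonal (d ζ) * S ζ) := by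
    filter_upwards [hdiag, Q.H_pos] with ζ h1 h2
    refine ⟨(Matrix.isUnit_iff_isUnit_det _).1 h1.1, (Matrix.isUnit_iff_isUnit_det _).1 h2.isUnit,
      ?_⟩
    rw [← h1.2, Matrix.nonsing_inv_mul_cancel_left _ _ hP1]
  have hinv : ∀ᵐ ζ ∂unitMeasure,
      Matrix.diagonal (d ζ) * (S ζ * (Q.H ζ)⁻¹ * Q.P1⁻¹ * (S ζ)⁻¹) = 1 := by
    filter_upwards [hdiag, hH] with ζ h1 h2
    have e : Matrix.diagonal (d ζ) = S ζ * (Q.P1 * Q.H ζ) * (S ζ)⁻¹ := by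
      rw [h1.2]
      simp only [Matrix.mul_assoc, Matrix.mul_nonsing_inv _ h2.1, Matrix.mul_one,
        Matrix.mul_nonsing_inv_cancel_left _ _ h2.1]
    rw [e]
    simp only [Matrix.mul_assoc, Matrix.nonsing_inv_mul_cancel_left _ _ h2.1,
      Matrix.mul_nonsing_inv_cancel_left _ _ h2.2.1, Matrix.mul_nonsing_inv_cancel_left _ _ hP1,
      Matrix.mul_nonsing_inv _ h2.1]
  have hne : ∀ i, ∀ ζ ∈ Icc (0 : ℝ) 1, d ζ i ≠ 0 := by
    intro i
    have hb := memLp_top_matrix_mul (memLp_top_matrix_mul (memLp_top_matrix_mul (hcd hS)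
      Q.H_inv_bounded) (hcd (hc Q.P1⁻¹))) (hcd hS') i i
    obtain ⟨C, hC0, hC⟩ : ∃ C > 0, ∀ᵐ ζ ∂unitMeasure,
        ‖(S ζ * (Q.H ζ)⁻¹ * Q.P1⁻¹ * (S ζ)⁻¹) i i‖ ≤ C := by
      exact ⟨max _ 1, by positivity,
        (ae_le_lpNorm_exponent_top hb).mono fun ζ h => h.trans (le_max_left _ 1)⟩
    have hlow : ∀ᵐ ζ ∂unitMeasure, 1 / C ≤ ‖d ζ i‖ := by
      filter_upwards [hC, hinv] with ζ h1 h2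
      have e := congrFun (congrFun h2 i) i
      rw [Matrix.diagonal_mul, Matrix.one_apply_eq] at e
      have e2 := congrArg norm e
      rw [norm_mul, norm_one] at e2
      rw [div_le_iff₀ hC0, ← e2]
      gcongr
    intro ζ hζ h0
    have := le_of_ae_le_of_continuousOn (hd i).continuousOn.norm hlow ζ hζ
    rw [h0, norm_zero] at this
    exact absurd this (not_le.2 (by positivity))
  refine ⟨fun ζ => Q.P1⁻¹ * ((S ζ)⁻¹ * Matrix.diagonal (d ζ) * S ζ),
    fun ζ => (S ζ)⁻¹ * Matrix.diagonal (fun i => (d ζ i)⁻¹) * S ζ * Q.P1,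
    contDiffOn_matrix_mul (hc Q.P1⁻¹) (contDiffOn_matrix_mul (contDiffOn_matrix_mul hS'
      (contDiffOn_matrix_diagonal hd)) hS),
    contDiffOn_matrix_mul (contDiffOn_matrix_mul (contDiffOn_matrix_mul hS'
      (contDiffOn_matrix_diagonal fun i => (hd i).inv (hne i))) hS) (hc Q.P1),
    hH.mono fun ζ h => h.2.2, ?_⟩
  filter_upwards [hH, ae_restrict_mem measurableSet_Icc] with ζ h hζ
  refine Matrix.inv_eq_left_inv ?_
  have e : Matrix.diagonal (fun i => (d ζ i)⁻¹) * Matrix.diagonal (d ζ) = 1 := by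
    rw [Matrix.diagonal_mul_diagonal, ← Matrix.diagonal_one]
    congr 1
    ext i
    exact inv_mul_cancel₀ (hne i ζ hζ)
  rw [h.2.2]
  simp only [Matrix.mul_assoc, Matrix.mul_nonsing_inv_cancel_left _ _ hP1,
    Matrix.mul_nonsing_inv_cancel_left _ _ h.1]
  rw [← Matrix.mul_assoc (Matrix.diagonal _) (Matrix.diagonal _), e, Matrix.one_mul,
    Matrix.nonsing_inv_mul _ h.1]

end PortHamiltonianSystem

/-! ### Integral identities on the domain of the generator -/

namespace PortHam

theorem IsPrimitive.clm_comp {E F : Type*} [NormedAddCommGroup E] [NormedSpace ℝ E]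
    [CompleteSpace E] [NormedAddCommGroup F] [NormedSpace ℝ F] [CompleteSpace F]
    (L : E →L[ℝ] F) {f f' : ℝ → E} (h : IsPrimitive f f') :
    IsPrimitive (fun ζ => L (f ζ)) (fun ζ => L (f' ζ)) := by
  refine ⟨L.integrable_comp h.integrableOn, fun ζ hζ => ?_⟩
  rw [L.intervalIntegral_comp_comm (h.intervalIntegrable hζ), ← map_add, ← h.eq_add_integral ζ hζ]

theorem IsPrimitive.of_hasDerivAt {f f' : ℝ → ℝ} (h : ∀ ζ, HasDerivAt f (f' ζ) ζ)
    (hc : Continuous f') : IsPrimitive f f' := by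
  refine ⟨hc.continuousOn.integrableOn_Icc, fun ζ _ => ?_⟩
  rw [intervalIntegral.integral_eq_sub_of_hasDerivAt (fun x _ => h x) (hc.intervalIntegrable _ _)]
  abel

variable {n : ℕ}

/-- The product rule for the inner product of two absolutely continuous functions. -/
theorem IsPrimitive.inner {u u' v v' : ℝ → Vec n} (hu : IsPrimitive u u')
    (hv : IsPrimitive v v') :
    IsPrimitive (fun ζ => (inner ℂ (u ζ) (v ζ)).re)
      (fun ζ => (inner ℂ (u' ζ) (v ζ)).re + (inner ℂ (u ζ) (v' ζ)).re) :=
  (hu.bilin (isBoundedBilinearMap_inner (𝕜 := ℂ) (E := Vec n)).toContinuousLinearMap hv).clm_comp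
    Complex.reCLM

/-- The product rule for an absolutely continuous operator-valued function applied to an absolutely
continuous function. -/
theorem IsPrimitive.apply {K K' : ℝ → Vec n →L[ℂ] Vec n} {v v' : ℝ → Vec n}
    (hK : IsPrimitive K K') (hv : IsPrimitive v v') :
    IsPrimitive (fun ζ => K ζ (v ζ)) (fun ζ => K' ζ (v ζ) + K ζ (v' ζ)) :=
  hK.bilin (ContinuousLinearMap.restrictScalarsL ℂ (Vec n) (Vec n) ℝ ℝ) hv

theorem re_inner_eq_integral (f g : StateSpace n) :
    (inner ℂ f g).re = ∫ ζ in (0 : ℝ)..1, (inner ℂ (f ζ) (g ζ)).re := by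
  rw [L2.inner_def, intervalIntegral.integral_of_le zero_le_one, ← integral_Icc_eq_integral_Ioc]
  exact (integral_re (L2.integrable_inner (𝕜 := ℂ) f g)).symm

theorem intervalIntegrable_re_inner (f g : StateSpace n) :
    IntervalIntegrable (fun ζ => (inner ℂ (f ζ) (g ζ)).re) volume 0 1 := by
  rw [intervalIntegrable_iff_integrableOn_Icc_of_le zero_le_one]
  exact (L2.integrable_inner (𝕜 := ℂ) f g).re

theorem ae_uIoc_of_ae_unitMeasure {p : ℝ → Prop} (h : ∀ᵐ ζ ∂unitMeasure, p ζ) :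
    ∀ᵐ ζ, ζ ∈ uIoc (0 : ℝ) 1 → p ζ := by
  filter_upwards [(ae_restrict_iff' measurableSet_Icc).1 h] with ζ hζ hI
  rw [uIoc_of_le zero_le_one] at hI
  exact hζ (Ioc_subset_Icc_self hI)

/-- A positive definite matrix is bounded below by the reciprocal of any bound for its inverse. -/
theorem norm_sq_le_of_posDef {A : Matrix (Fin n) (Fin n) ℂ} (hA : A.PosDef) {k : ℝ} (hk : 0 < k)
    (h : ‖act A⁻¹‖ ≤ k) (v : Vec n) : ‖v‖ ^ 2 ≤ k * (inner ℂ v (act A v)).re := by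
  have hdet : IsUnit A.det := (Matrix.isUnit_iff_isUnit_det _).1 hA.isUnit
  have hpos := hA.inv.posSemidef
  have e1 : act A⁻¹ (act A v) = v := by
    rw [← act_mul_apply, Matrix.nonsing_inv_mul _ hdet, act_one_apply]
  set w := act A v
  have e2 : (inner ℂ w (act A⁻¹ v)).re = ‖v‖ ^ 2 := by
    have := inner_act_left A⁻¹ w v
    rw [hpos.isHermitian.eq, e1] at this
    rw [← this]
    exact inner_self_eq_norm_sq (𝕜 := ℂ) v
  have e3 : (inner ℂ v v).re = ‖v‖ ^ 2 := inner_self_eq_norm_sq (𝕜 := ℂ) v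
  have e4 : (inner ℂ v (act A⁻¹ v)).re ≤ k * ‖v‖ ^ 2 := by
    calc (inner ℂ v (act A⁻¹ v)).re ≤ ‖v‖ * ‖act A⁻¹ v‖ := re_inner_le_norm (𝕜 := ℂ) _ _
      _ ≤ ‖v‖ * (k * ‖v‖) := by
        gcongr
        exact (act A⁻¹).le_of_opNorm_le h v
      _ = k * ‖v‖ ^ 2 := by ring
  have e5 : (inner ℂ w v).re = (inner ℂ v w).re := inner_re_symm (𝕜 := ℂ) _ _
  -- positivity of `A⁻¹` at the vector `A v - k⁻¹ v`, scaled by `k`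
  have key := re_inner_act_nonneg hpos ((k : ℂ) • w - v)
  rw [map_sub, map_smul, e1, inner_sub_left, inner_sub_right, inner_sub_right, inner_smul_left,
    inner_smul_left, inner_smul_right, inner_smul_right] at key
  simp only [Complex.conj_ofReal, Complex.sub_re, Complex.re_ofReal_mul, e2, e3, e5] at key
  have h6 : 0 ≤ k * (k * (inner ℂ v w).re - ‖v‖ ^ 2) := by nlinarith
  have := nonneg_of_mul_nonneg_right h6 hk
  linarith

end PortHam

namespace PortHamiltonianSystem

open PortHam

variable {n : ℕ} (Q : PortHamiltonianSystem n)

theorem isPrimitive_effort (z : Q.domain) : IsPrimitive (Q.effort z) (Q.effortDeriv z) :=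
  (Q.isEffort z).2.isPrimitive

theorem coeFn_A (z : Q.domain) : (Q.A z : StateSpace n) =ᵐ[unitMeasure]
    fun ζ => act Q.P1 (Q.effortDeriv z ζ) + act Q.G0 (Q.effort z ζ) :=
  (Q.memLp_A z).coeFn_toLp

theorem isUnit_det_P1 : IsUnit Q.P1.det := (Matrix.isUnit_iff_isUnit_det _).1 Q.P1_invertible

variable {Q} {P K : ℝ → Vec n →L[ℂ] Vec n} (hP : ContinuousOn P (Icc 0 1))
  (hPH : ∀ᵐ ζ ∂unitMeasure, act (Q.H ζ) = P ζ)

include hPH in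
theorem coeFn_mulOp_effort (z : Q.domain) : mulOp P hP z =ᵐ[unitMeasure] Q.effort z := by
  filter_upwards [coeFn_mulOp P hP z, hPH, (Q.isEffort z).1] with ζ h1 h2 h3
  rw [h1, h3, h2]

include hP hPH in
/-- The boundary values of the effort are bounded by the graph norm: integrate the derivative of
`(ζ - c) w(ζ)` over `[0,1]`. The values `c = 0` and `c = 1` give the two traces. -/
theorem exists_trace (c : ℝ) : ∃ U V : StateSpace n →L[ℂ] Vec n, ∀ z : Q.domain,
    (1 - c) • Q.effort z 1 + c • Q.effort z 0 = U z + V (Q.A z) := by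
  have hW : ContinuousOn (fun ζ : ℝ => (ζ - c) • act Q.P1⁻¹) (Icc 0 1) := by fun_prop
  have hG : ContinuousOn (fun _ : ℝ => act Q.G0) (Icc 0 1) := continuousOn_const
  set W := mulOp _ hW
  set G := mulOp _ hG
  refine ⟨meanL ∘L (mulOp P hP - W ∘L G ∘L mulOp P hP), meanL ∘L W, fun z => ?_⟩
  have hζ : IsPrimitive (fun ζ : ℝ => ζ - c) (fun _ => 1) :=
    IsPrimitive.of_hasDerivAt (fun ζ => (hasDerivAt_id ζ).sub_const c) continuous_const
  have key := (hζ.bilin (ContinuousLinearMap.lsmul ℝ ℝ) (Q.isPrimitive_effort z)).eq_add_integral 1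
    (by norm_num)
  simp only [ContinuousLinearMap.lsmul_apply, one_smul, zero_sub] at key
  have e : meanL (mulOp P hP z - W (G (mulOp P hP z)) + W (Q.A z)) =
      ∫ ζ in (0 : ℝ)..1, (Q.effort z ζ + (ζ - c) • Q.effortDeriv z ζ) := by
    rw [meanL_apply]
    refine intervalIntegral.integral_congr_ae (ae_uIoc_of_ae_unitMeasure ?_)
    filter_upwards [coeFn_mulOp_effort hP hPH z, Q.coeFn_A z, coeFn_mulOp _ hW (Q.A z),
      coeFn_mulOp _ hW (G (mulOp P hP z)), coeFn_mulOp _ hG (mulOp P hP z),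
      Lp.coeFn_add (mulOp P hP z - W (G (mulOp P hP z))) (W (Q.A z)),
      Lp.coeFn_sub (mulOp P hP z) (W (G (mulOp P hP z)))] with ζ h1 h2 h3 h4 h5 h6 h7
    have e1 : act Q.P1⁻¹ (act Q.P1 (Q.effortDeriv z ζ)) = Q.effortDeriv z ζ := by
      rw [← act_mul_apply, Matrix.nonsing_inv_mul _ Q.isUnit_det_P1, act_one_apply]
    rw [h6, Pi.add_apply, h7, Pi.sub_apply, h3, h4, h5, h1, h2]
    simp only [smul_apply, map_add, e1]
    abel
  simp only [ContinuousLinearMap.comp_apply, sub_apply, map_sub]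
  rw [map_add, map_sub] at e
  rw [e, key]
  simp

include hPH in
/-- The energy balance: as `Re G₀ = 0`, energy is exchanged through the boundary only. -/
theorem energy_balance (hG0 : Q.G0 + Q.G0ᴴ = 0) (z : Q.domain) :
    2 * (inner ℂ (mulOp P hP z) (Q.A z)).re =
      (inner ℂ (Q.effort z 1) (act Q.P1 (Q.effort z 1))).re -
        (inner ℂ (Q.effort z 0) (act Q.P1 (Q.effort z 0))).re := by
  have hw := Q.isPrimitive_effort z
  have key := (hw.inner (hw.clm_comp ((act Q.P1).restrictScalars ℝ))).eq_add_integral 1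
    (by norm_num)
  simp only [ContinuousLinearMap.coe_restrictScalars'] at key
  rw [key, add_sub_cancel_left, re_inner_eq_integral, ← intervalIntegral.integral_const_mul]
  refine intervalIntegral.integral_congr_ae (ae_uIoc_of_ae_unitMeasure ?_)
  filter_upwards [coeFn_mulOp_effort hP hPH z, Q.coeFn_A z] with ζ h1 h2
  rw [h1, h2, inner_add_right, Complex.add_re]
  have e1 : (inner ℂ (Q.effortDeriv z ζ) (act Q.P1 (Q.effort z ζ))).re =
      (inner ℂ (Q.effort z ζ) (act Q.P1 (Q.effortDeriv z ζ))).re := by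
    have h := inner_act_left Q.P1 (Q.effortDeriv z ζ) (Q.effort z ζ)
    rw [Q.P1_hermitian.eq] at h
    rw [← h]
    exact inner_re_symm (𝕜 := ℂ) _ _
  have e2 : (inner ℂ (Q.effort z ζ) (act Q.G0 (Q.effort z ζ))).re = 0 := by
    have h := inner_act_left Q.G0 (Q.effort z ζ) (Q.effort z ζ)
    rw [eq_neg_of_add_eq_zero_right hG0, show act (-Q.G0) = -act Q.G0 from map_neg _ _, neg_apply,
      inner_neg_right] at h
    have h' := congrArg Complex.re h
    have hs : (inner ℂ (act Q.G0 (Q.effort z ζ)) (Q.effort z ζ)).re =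
      (inner ℂ (Q.effort z ζ) (act Q.G0 (Q.effort z ζ))).re := inner_re_symm (𝕜 := ℂ) _ _
    rw [Complex.neg_re] at h'
    linarith
  rw [e1, e2]
  ring

include hPH in
theorem norm_sq_le_energy {k : ℝ} (hk : 0 < k)
    (hkN : ∀ᵐ ζ ∂unitMeasure, ‖act (Q.H ζ)⁻¹‖ ≤ k) (x : StateSpace n) :
    ‖x‖ ^ 2 ≤ k * (inner ℂ x (mulOp P hP x)).re := by
  have e : ‖x‖ ^ 2 = (inner ℂ x x).re := (inner_self_eq_norm_sq (𝕜 := ℂ) x).symm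
  rw [e, re_inner_eq_integral, re_inner_eq_integral, ← intervalIntegral.integral_const_mul]
  refine intervalIntegral.integral_mono_ae_restrict zero_le_one (intervalIntegrable_re_inner _ _)
    ((intervalIntegrable_re_inner _ _).const_mul k) ?_
  filter_upwards [hPH, Q.H_pos, hkN, coeFn_mulOp P hP x] with ζ h1 h2 h3 h4
  rw [h4, ← h1]
  refine le_trans (le_of_eq ?_) (norm_sq_le_of_posDef h2 hk h3 (x ζ))
  exact inner_self_eq_norm_sq (𝕜 := ℂ) (x ζ)

variable (Q) in
/-- A growth rate `κ` of the weight in the multiplier estimate, for bounds `p`, `k`, `k'` of the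
Hamiltonian density, its inverse and the derivative of its inverse. -/
noncomputable def multiplierRate (p k k' : ℝ) : ℝ :=
  (k' * p ^ 2 + 2 * |‖act Q.P1⁻¹‖ * (‖act Q.G0‖ * p)|) * (k + 1) + 1

/-- The pointwise form of the multiplier estimate, for a positive definite `A` with effort `A x`.
The rate of the weight is chosen to absorb the terms of order zero, those with the derivative `L` of
the inverse density and with `G₀`. -/
theorem multiplier_pointwise {A : Matrix (Fin n) (Fin n) ℂ} (hA : A.PosDef)
    {p k k' m : ℝ} (hk0 : 0 ≤ k) (hp : ‖act A‖ ≤ p) (hk : ‖act A⁻¹‖ ≤ k)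
    {L : Vec n →L[ℂ] Vec n} (hL : ‖L‖ ≤ k') (hm : 1 ≤ m) (x g : Vec n) :
    2 * (inner ℂ (m • act Q.P1⁻¹ x) (act Q.P1 g + act Q.G0 (act A x))).re
        + (inner ℂ x (act A x)).re ≤
      Q.multiplierRate p k k' * m * (inner ℂ (act A x) (act A⁻¹ (act A x))).re + m *
        ((inner ℂ g (act A⁻¹ (act A x))).re +
          (inner ℂ (act A x) (L (act A x) + act A⁻¹ g)).re) := by
  have hdet : IsUnit A.det := (Matrix.isUnit_iff_isUnit_det _).1 hA.isUnit
  have hp0 : 0 ≤ p := (norm_nonneg _).trans hp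
  have hk'0 : 0 ≤ k' := (norm_nonneg _).trans hL
  have hwx : ‖act A x‖ ≤ p * ‖x‖ := (act A).le_of_opNorm_le hp _
  have hcoer : ‖x‖ ^ 2 ≤ (k + 1) * (inner ℂ x (act A x)).re :=
    norm_sq_le_of_posDef hA (by positivity) (hk.trans (by linarith)) x
  have hwx0 : 0 ≤ (inner ℂ x (act A x)).re := re_inner_act_nonneg hA.posSemidef x
  have eKw : act A⁻¹ (act A x) = x := by
    rw [← act_mul_apply, Matrix.nonsing_inv_mul _ hdet, act_one_apply]
  generalize act A x = w at *
  have eKg : (inner ℂ w (act A⁻¹ g)).re = (inner ℂ x g).re := by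
    have := inner_act_left A⁻¹ w g
    rw [hA.inv.isHermitian.eq, eKw] at this
    rw [this]
  have eP : (inner ℂ (act Q.P1⁻¹ x) (act Q.P1 g)).re = (inner ℂ x g).re := by
    rw [inner_act_left, Q.P1_hermitian.inv.eq, ← act_mul_apply,
      Matrix.nonsing_inv_mul _ Q.isUnit_det_P1, act_one_apply]
  have s1 : (inner ℂ g x).re = (inner ℂ x g).re := inner_re_symm (𝕜 := ℂ) _ _
  have s2 : (inner ℂ w x).re = (inner ℂ x w).re := inner_re_symm (𝕜 := ℂ) _ _
  have b1 : -(k' * p ^ 2 * ‖x‖ ^ 2) ≤ (inner ℂ w (L w)).re := by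
    refine neg_le_of_abs_le ?_
    calc |(inner ℂ w (L w)).re| ≤ ‖w‖ * ‖L w‖ :=
          (Complex.abs_re_le_norm _).trans (norm_inner_le_norm _ _)
      _ ≤ ‖w‖ * (k' * ‖w‖) := by
        gcongr
        exact L.le_of_opNorm_le hL _
      _ ≤ (p * ‖x‖) * (k' * (p * ‖x‖)) := by gcongr
      _ = k' * p ^ 2 * ‖x‖ ^ 2 := by ring
  have b2 : (inner ℂ (act Q.P1⁻¹ x) (act Q.G0 w)).re ≤
      ‖act Q.P1⁻¹‖ * (‖act Q.G0‖ * p) * ‖x‖ ^ 2 := by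
    calc (inner ℂ (act Q.P1⁻¹ x) (act Q.G0 w)).re
        ≤ ‖act Q.P1⁻¹ x‖ * ‖act Q.G0 w‖ := re_inner_le_norm (𝕜 := ℂ) _ _
      _ ≤ (‖act Q.P1⁻¹‖ * ‖x‖) * (‖act Q.G0‖ * (p * ‖x‖)) := by
        gcongr
        · exact (act Q.P1⁻¹).le_opNorm x
        · exact ((act Q.G0).le_opNorm _).trans (by gcongr)
      _ = ‖act Q.P1⁻¹‖ * (‖act Q.G0‖ * p) * ‖x‖ ^ 2 := by ring
  rw [inner_add_right, inner_add_right, ← algebraMap_smul ℂ m, inner_smul_left, inner_smul_left,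
    eKw]
  simp only [Complex.coe_algebraMap, Complex.conj_ofReal, Complex.add_re,
    Complex.re_ofReal_mul, eP, eKg, s1, s2]
  generalize (inner ℂ x w).re = I at *
  generalize (inner ℂ x g).re = J at *
  generalize (inner ℂ w (L w)).re = D at *
  generalize (inner ℂ (act Q.P1⁻¹ x) (act Q.G0 w)).re = B at *
  rw [multiplierRate]
  generalize ‖act Q.P1⁻¹‖ * (‖act Q.G0‖ * p) = c at *
  have c0 : 0 ≤ (k' * p ^ 2 + 2 * |c|) := by positivity
  have hB : B ≤ |c| * ‖x‖ ^ 2 := b2.trans (by gcongr; exact le_abs_self c)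
  have h9 := mul_le_mul_of_nonneg_left hcoer c0
  have h10 : 2 * B + I ≤ ((k' * p ^ 2 + 2 * |c|) * (k + 1) + 1) * I + D := by linarith
  have h11 := mul_le_mul_of_nonneg_left h10 (zero_le_one.trans hm)
  have h12 := mul_le_mul_of_nonneg_right hm hwx0
  linarith

include hPH in
/-- The multiplier estimate. The operator is multiplication by `e^{κζ} P₁⁻¹`; since
`x^* P₁⁻¹ x = w^* K P₁⁻¹ K w` is the flux conjugate to `w^* K w` when the roles of space and time
are exchanged, its derivative along the flow is, up to boundary terms, at most minus the energy, once
`κ` is so large that the derivative of the weight absorbs the terms of order zero. -/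
theorem exists_multiplier (hK : ContDiffOn ℝ 1 K (Icc 0 1))
    (hKH : ∀ᵐ ζ ∂unitMeasure, act (Q.H ζ)⁻¹ = K ζ) :
    ∃ (R : StateSpace n →L[ℂ] StateSpace n) (C : ℝ),
      (∀ x y, inner ℂ (R x) y = inner ℂ x (R y)) ∧ 0 ≤ C ∧ ∀ z : Q.domain,
        2 * (inner ℂ (R z) (Q.A z)).re ≤
          C * (‖Q.effort z 1‖ ^ 2 + ‖Q.effort z 0‖ ^ 2) -
            (inner ℂ (z : StateSpace n) (mulOp P hP z)).re := by
  have hKc := hK.continuousOn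
  have hKp := IsPrimitive.of_contDiffOn hK
  set K' := derivWithin K (Icc (0 : ℝ) 1)
  have hK'c : ContinuousOn K' (Icc 0 1) :=
    hK.continuousOn_derivWithin (uniqueDiffOn_Icc (by norm_num)) le_rfl
  obtain ⟨p, hp⟩ := isCompact_Icc.exists_bound_of_continuousOn hP
  obtain ⟨k, hk⟩ := isCompact_Icc.exists_bound_of_continuousOn hKc
  obtain ⟨k', hk'⟩ := isCompact_Icc.exists_bound_of_continuousOn hK'c
  have h01 : (0 : ℝ) ∈ Icc (0 : ℝ) 1 := by norm_num
  have h11 : (1 : ℝ) ∈ Icc (0 : ℝ) 1 := by norm_num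
  have hp0 : 0 ≤ p := (norm_nonneg _).trans (hp 0 h01)
  have hk0 : 0 ≤ k := (norm_nonneg _).trans (hk 0 h01)
  have hk'0 : 0 ≤ k' := (norm_nonneg _).trans (hk' 0 h01)
  set κ : ℝ := Q.multiplierRate p k k' with hκ
  have hκ0 : 0 ≤ κ := by rw [hκ, multiplierRate]; positivity
  set m : ℝ → ℝ := fun ζ => Real.exp (κ * ζ) with hm
  have hmp : IsPrimitive m (fun ζ => κ * m ζ) := by
    refine IsPrimitive.of_hasDerivAt (fun ζ => ?_) (by fun_prop)
    have := ((hasDerivAt_id ζ).const_mul κ).exp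
    simpa [hm, mul_comm] using this
  have hR : ContinuousOn (fun ζ : ℝ => m ζ • act Q.P1⁻¹) (Icc 0 1) := by fun_prop
  have hP1i : (Q.P1⁻¹)ᴴ = Q.P1⁻¹ := Q.P1_hermitian.inv.eq
  refine ⟨mulOp _ hR, Real.exp κ * k, mulOp_inner_left hR (Eventually.of_forall fun ζ u v => ?_),
    by positivity, fun z => ?_⟩
  · rw [smul_apply, smul_apply, ← algebraMap_smul ℂ (m ζ), ← algebraMap_smul ℂ (m ζ),
      inner_smul_left, inner_smul_right, inner_act_left, hP1i]
    simp
  have hw := Q.isPrimitive_effort z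
  have hprim := hmp.bilin (ContinuousLinearMap.lsmul ℝ ℝ) (hw.inner (hKp.apply hw))
  have key := hprim.eq_add_integral 1 h11
  have hint := hprim.intervalIntegrable h11
  simp only [ContinuousLinearMap.lsmul_apply, smul_eq_mul] at key hint
  have hbdry (ζ : ℝ) (hζ : ζ ∈ Icc (0 : ℝ) 1) :
      |(inner ℂ (Q.effort z ζ) (K ζ (Q.effort z ζ))).re| ≤ k * ‖Q.effort z ζ‖ ^ 2 := by
    calc |(inner ℂ (Q.effort z ζ) (K ζ (Q.effort z ζ))).re|
        ≤ ‖Q.effort z ζ‖ * ‖K ζ (Q.effort z ζ)‖ :=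
          (Complex.abs_re_le_norm _).trans (norm_inner_le_norm _ _)
      _ ≤ ‖Q.effort z ζ‖ * (k * ‖Q.effort z ζ‖) := by
        gcongr
        exact (K ζ).le_of_opNorm_le (hk ζ hζ) _
      _ = k * ‖Q.effort z ζ‖ ^ 2 := by ring
  have hmono : ∫ ζ in (0 : ℝ)..1, (2 * (inner ℂ (mulOp _ hR (z : StateSpace n) ζ) (Q.A z ζ)).re
        + (inner ℂ ((z : StateSpace n) ζ) (mulOp P hP z ζ)).re) ≤
      ∫ ζ in (0 : ℝ)..1, (κ * m ζ * (inner ℂ (Q.effort z ζ) (K ζ (Q.effort z ζ))).re + m ζ *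
        ((inner ℂ (Q.effortDeriv z ζ) (K ζ (Q.effort z ζ))).re +
          (inner ℂ (Q.effort z ζ) (K' ζ (Q.effort z ζ) + K ζ (Q.effortDeriv z ζ))).re)) := by
    refine intervalIntegral.integral_mono_ae_restrict zero_le_one
      (((intervalIntegrable_re_inner _ _).const_mul 2).add (intervalIntegrable_re_inner _ _))
      hint ?_
    filter_upwards [coeFn_mulOp _ hR z, coeFn_mulOp_effort hP hPH z, Q.coeFn_A z, hPH, hKH, Q.H_pos,
      (Q.isEffort z).1, ae_restrict_mem measurableSet_Icc] with ζ h1 h2 h3 h4 h5 h6 h7 hζ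
    have h8 : mulOp P hP (z : StateSpace n) ζ = Q.effort z ζ := h2
    rw [h1, h3, h8, ← h5, h7, smul_apply]
    exact multiplier_pointwise h6 hk0 (h4 ▸ hp ζ hζ) (h5 ▸ hk ζ hζ) (hk' ζ hζ)
      (Real.one_le_exp (mul_nonneg hκ0 hζ.1)) _ _
  rw [intervalIntegral.integral_add ((intervalIntegrable_re_inner _ _).const_mul 2)
    (intervalIntegrable_re_inner _ _), intervalIntegral.integral_const_mul, ← re_inner_eq_integral,
    ← re_inner_eq_integral] at hmono
  have hm0 : m 0 = 1 := by simp [hm]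
  have hm1 : m 1 = Real.exp κ := by simp [hm]
  have he : 1 ≤ Real.exp κ := Real.one_le_exp hκ0
  have hb1 := mul_le_mul_of_nonneg_left (le_of_abs_le (hbdry 1 h11)) (zero_le_one.trans he)
  have hb0 := neg_le_of_abs_le (hbdry 0 h01)
  have hb0' : k * ‖Q.effort z 0‖ ^ 2 ≤ Real.exp κ * k * ‖Q.effort z 0‖ ^ 2 := by
    rw [mul_assoc]
    exact le_mul_of_one_le_left (by positivity) he
  rw [hm0, hm1] at key
  linarith

end PortHamiltonianSystem

/-! ### Quadratic functionals along orbits -/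

/-- The evolution of a quadratic functional along an orbit in the domain of the generator. -/
theorem C0Semigroup.IsGenerator.re_inner_sub_eq_integral {X : Type*} [NormedAddCommGroup X]
    [InnerProductSpace ℂ X] [CompleteSpace X] [NormedSpace ℝ X] [IsScalarTower ℝ ℂ X]
    {T : C0Semigroup X} {A : X →ₗ.[ℂ] X} (h : T.IsGenerator A) {R : X →L[ℂ] X}
    (hR : ∀ x y, inner ℂ (R x) y = inner ℂ x (R y)) (x : A.domain) {τ : ℝ} (hτ : 0 ≤ τ) :
    (inner ℂ (T.op τ x) (R (T.op τ x))).re - (inner ℂ (x : X) (R x)).re =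
      ∫ t in (0 : ℝ)..τ, 2 * (inner ℂ (R (T.op t x)) (T.op t (A x))).re := by
  have c1 : ContinuousOn (fun t => T.op t x) (Icc 0 τ) :=
    (T.continuousOn_orbit x).mono Icc_subset_Ici_self
  have c2 : ContinuousOn (fun t => T.op t (A x)) (Icc 0 τ) :=
    (T.continuousOn_orbit (A x)).mono Icc_subset_Ici_self
  have c3 := R.continuous.comp_continuousOn c1
  rw [intervalIntegral.integral_eq_sub_of_hasDeriv_right_of_le hτ
    (f := fun t => (inner ℂ (T.op t x) (R (T.op t x))).re)]
  · rw [T.op_zero]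
    rfl
  · exact Complex.continuous_re.comp_continuousOn (c1.inner c3)
  · intro t ht
    have d := h.hasDerivWithinAt_orbit ht.1.le x
    have d' := (R.restrictScalars ℝ).hasFDerivAt.comp_hasDerivWithinAt t d
    have d'' := Complex.reCLM.hasFDerivAt.comp_hasDerivWithinAt t (d.inner ℂ d')
    refine d''.congr_deriv ?_
    have e1 : (inner ℂ (T.op t (A x)) (R (T.op t x))).re =
      (inner ℂ (R (T.op t x)) (T.op t (A x))).re := inner_re_symm (𝕜 := ℂ) _ _
    simp only [ContinuousLinearMap.coe_restrictScalars', Complex.reCLM_apply, Complex.add_re,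
      Function.comp_apply, e1, ← hR (T.op t x)]
    ring
  · refine ContinuousOn.intervalIntegrable_of_Icc hτ ?_
    exact (Complex.continuous_re.comp_continuousOn (c3.inner c2)).const_mul 2

/-- An energy `E` that varies by at most the observation `Y`, and that is controlled in the mean by
`Y` and by the variation of a functional `Ψ` it dominates, is observable over any time longer than
twice the domination constant. -/
theorem initial_energy_le_integral {E Ψ Y e ψ : ℝ → ℝ} {τ c₁ c₂ c₃ : ℝ} (hτ : 0 ≤ τ)
    (hc₁ : 0 ≤ c₁) (hc₃ : 0 ≤ c₃)
    (hE : ∀ t ∈ Icc 0 τ, E t - E 0 = ∫ s in (0 : ℝ)..t, e s)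
    (hΨ : Ψ τ - Ψ 0 = ∫ s in (0 : ℝ)..τ, ψ s)
    (he : ∀ t ∈ Icc 0 τ, |e t| ≤ c₁ * Y t) (hψ : ∀ t ∈ Icc 0 τ, ψ t ≤ c₂ * Y t - E t)
    (hΨE : ∀ t ∈ Icc 0 τ, |Ψ t| ≤ c₃ * E t) (hY0 : ∀ t, 0 ≤ Y t)
    (hYc : ContinuousOn Y (Icc 0 τ)) (hEc : ContinuousOn E (Icc 0 τ))
    (hec : ContinuousOn e (Icc 0 τ)) (hψc : ContinuousOn ψ (Icc 0 τ)) :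
    (τ - 2 * c₃) * E 0 ≤ (c₂ + c₁ * τ + c₁ * c₃) * ∫ t in (0 : ℝ)..τ, Y t := by
  have h0 : (0 : ℝ) ∈ Icc 0 τ := ⟨le_rfl, hτ⟩
  have h1 : τ ∈ Icc 0 τ := ⟨hτ, le_rfl⟩
  have ii {f : ℝ → ℝ} (hf : ContinuousOn f (Icc 0 τ)) {t : ℝ} (ht : t ∈ Icc 0 τ) :
      IntervalIntegrable f volume 0 t :=
    (hf.mono (Icc_subset_Icc_right ht.2)).intervalIntegrable_of_Icc ht.1
  have hvar : ∀ t ∈ Icc 0 τ, |E t - E 0| ≤ c₁ * ∫ s in (0 : ℝ)..τ, Y s := by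
    intro t ht
    have hY : ∫ s in (0 : ℝ)..t, Y s ≤ ∫ s in (0 : ℝ)..τ, Y s :=
      intervalIntegral.integral_mono_interval le_rfl ht.1 ht.2
        (Eventually.of_forall fun s => hY0 s) (ii hYc h1)
    calc |E t - E 0| ≤ ∫ s in (0 : ℝ)..t, |e s| := by
          rw [hE t ht]
          exact intervalIntegral.abs_integral_le_integral_abs ht.1
      _ ≤ ∫ s in (0 : ℝ)..t, c₁ * Y s := by
          refine intervalIntegral.integral_mono_on ht.1 (ii hec.abs ht) ((ii hYc ht).const_mul c₁)
            fun s hs => he s ⟨hs.1, hs.2.trans ht.2⟩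
      _ ≤ c₁ * ∫ s in (0 : ℝ)..τ, Y s := by
          rw [intervalIntegral.integral_const_mul]
          gcongr
  have hEint : τ * (E 0 - c₁ * ∫ s in (0 : ℝ)..τ, Y s) ≤ ∫ t in (0 : ℝ)..τ, E t := by
    have := intervalIntegral.integral_mono_on hτ
      (intervalIntegrable_const (c := E 0 - c₁ * ∫ s in (0 : ℝ)..τ, Y s)) (ii hEc h1)
      fun t ht => by linarith [neg_le_of_abs_le (hvar t ht)]
    rwa [intervalIntegral.integral_const, smul_eq_mul, sub_zero] at this
  have hΨint : Ψ τ - Ψ 0 ≤ c₂ * (∫ t in (0 : ℝ)..τ, Y t) - ∫ t in (0 : ℝ)..τ, E t := by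
    rw [hΨ, ← intervalIntegral.integral_const_mul,
      ← intervalIntegral.integral_sub ((ii hYc h1).const_mul c₂) (ii hEc h1)]
    exact intervalIntegral.integral_mono_on hτ (ii hψc h1)
      (((ii hYc h1).const_mul c₂).sub (ii hEc h1)) hψ
  have a0 := le_of_abs_le (hΨE 0 h0)
  have a1 := neg_le_of_abs_le (hΨE τ h1)
  have a2 := mul_le_mul_of_nonneg_left (le_of_abs_le (hvar τ h1)) hc₃
  linarith

namespace PortHamiltonianSystem

open PortHam

variable {n : ℕ} {Q : PortHamiltonianSystem n}

/-! ### Boundary values and output -/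

theorem boundary_condition (z : Q.domain) :
    act Q.WB1 (Q.effort z 1) + act Q.WB0 (Q.effort z 0) = 0 :=
  z.2.choose_spec.choose_spec.2

theorem output_coe (z : Q.domain) : Q.output (z : StateSpace n) =
    act Q.WC1 (Q.effort z 1) + act Q.WC0 (Q.effort z 0) := by
  rw [output, dif_pos z.2]

/-- Since `W_BC` is invertible, the output determines both boundary values of the effort. -/
theorem exists_boundary_le_output (hW : IsUnit Q.WBC) : ∃ c : ℝ, 0 ≤ c ∧ ∀ z : Q.domain,
    ‖Q.effort z 1‖ ^ 2 + ‖Q.effort z 0‖ ^ 2 ≤ c * ‖Q.output (z : StateSpace n)‖ ^ 2 := by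
  refine ⟨‖act (Q.WBC⁻¹).toBlocks₁₂‖ ^ 2 + ‖act (Q.WBC⁻¹).toBlocks₂₂‖ ^ 2, by positivity,
    fun z => ?_⟩
  set a := Q.effort z 1
  set b := Q.effort z 0
  have h1 : Q.WB1 *ᵥ a.ofLp + Q.WB0 *ᵥ b.ofLp = 0 :=
    congrArg WithLp.ofLp (boundary_condition z)
  have h2 : Q.WC1 *ᵥ a.ofLp + Q.WC0 *ᵥ b.ofLp = (Q.output (z : StateSpace n)).ofLp :=
    (congrArg WithLp.ofLp (output_coe z)).symm
  generalize Q.output (z : StateSpace n) = y at *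
  have e : Q.WBC *ᵥ Sum.elim a.ofLp b.ofLp = Sum.elim (0 : Fin n → ℂ) y.ofLp := by
    rw [WBC, Matrix.fromBlocks_mulVec]
    simp [Function.comp_def, h1, h2]
  have e' : Sum.elim a.ofLp b.ofLp = Q.WBC⁻¹ *ᵥ Sum.elim (0 : Fin n → ℂ) y.ofLp := by
    rw [← e, Matrix.mulVec_mulVec,
      Matrix.nonsing_inv_mul _ ((Matrix.isUnit_iff_isUnit_det _).1 hW), Matrix.one_mulVec]
  rw [← Matrix.fromBlocks_toBlocks Q.WBC⁻¹, Matrix.fromBlocks_mulVec, Sum.elim_comp_inl,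
    Sum.elim_comp_inr, Matrix.mulVec_zero, Matrix.mulVec_zero, zero_add, zero_add] at e'
  have ea : a = act (Q.WBC⁻¹).toBlocks₁₂ y := by
    refine WithLp.ofLp_injective 2 (funext fun i => ?_)
    exact congrFun e' (Sum.inl i)
  have eb : b = act (Q.WBC⁻¹).toBlocks₂₂ y := by
    refine WithLp.ofLp_injective 2 (funext fun i => ?_)
    exact congrFun e' (Sum.inr i)
  have na : ‖a‖ ≤ ‖act (Q.WBC⁻¹).toBlocks₁₂‖ * ‖y‖ := ea ▸ ContinuousLinearMap.le_opNorm _ _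
  have nb : ‖b‖ ≤ ‖act (Q.WBC⁻¹).toBlocks₂₂‖ * ‖y‖ := eb ▸ ContinuousLinearMap.le_opNorm _ _
  calc ‖a‖ ^ 2 + ‖b‖ ^ 2 ≤ (‖act (Q.WBC⁻¹).toBlocks₁₂‖ * ‖y‖) ^ 2 +
        (‖act (Q.WBC⁻¹).toBlocks₂₂‖ * ‖y‖) ^ 2 := by gcongr
    _ = _ := by ring

/-- The output of a classical solution is continuous in time. -/
theorem continuousOn_output {P : ℝ → Vec n →L[ℂ] Vec n} (hP : ContinuousOn P (Icc 0 1))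
    (hPH : ∀ᵐ ζ ∂unitMeasure, act (Q.H ζ) = P ζ) {T : C0Semigroup (StateSpace n)}
    (hgen : T.IsGenerator Q.A) (x : Q.A.domain) :
    ContinuousOn (fun t => Q.output (T.op t x)) (Ici 0) := by
  obtain ⟨U₁, V₁, h₁⟩ := exists_trace (Q := Q) hP hPH 0
  obtain ⟨U₀, V₀, h₀⟩ := exists_trace (Q := Q) hP hPH 1
  have c1 := T.continuousOn_orbit x
  have c2 := T.continuousOn_orbit (Q.A x)
  have c : ContinuousOn (fun t => act Q.WC1 (U₁ (T.op t x) + V₁ (T.op t (Q.A x))) +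
      act Q.WC0 (U₀ (T.op t x) + V₀ (T.op t (Q.A x)))) (Ici 0) := by fun_prop
  refine c.congr fun t ht => ?_
  set z : Q.domain := ⟨T.op t x, hgen.op_mem_domain ht x.2⟩
  have ez : Q.A z = T.op t (Q.A x) := hgen.apply_op ht x
  have e1 := h₁ z
  have e0 := h₀ z
  rw [ez] at e1 e0
  simp only [sub_zero, one_smul, zero_smul, add_zero, sub_self, zero_add] at e1 e0
  have := output_coe z
  rw [e1, e0] at this
  exact this

theorem energyNorm_sq {P : ℝ → Vec n →L[ℂ] Vec n} (hP : ContinuousOn P (Icc 0 1))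
    (hPH : ∀ᵐ ζ ∂unitMeasure, act (Q.H ζ) = P ζ) (x : StateSpace n) :
    Q.energyNorm x ^ 2 = (inner ℂ x (mulOp P hP x)).re := by
  have h0 : 0 ≤ ∫ ζ, (inner ℂ (x ζ) (act (Q.H ζ) (x ζ))).re ∂unitMeasure := by
    refine integral_nonneg_of_ae ?_
    filter_upwards [Q.H_pos] with ζ h
    exact re_inner_act_nonneg h.posSemidef _
  rw [energyNorm, Real.sq_sqrt h0, re_inner_eq_integral,
    intervalIntegral.integral_of_le zero_le_one, ← integral_Icc_eq_integral_Ioc]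
  refine integral_congr_ae ?_
  filter_upwards [hPH, coeFn_mulOp P hP x] with ζ h1 h2
  rw [h1, h2]

/-! ### Exact observability -/

/-- Exact observability under full boundary observation and skew-adjoint `G₀`. The observation time
exceeds twice the constant by which the energy dominates the multiplier functional. -/
theorem exactlyObservableInFiniteTime {T : C0Semigroup (StateSpace n)} (hgen : T.IsGenerator Q.A)
    (hWBC : IsUnit Q.WBC) (hG : Q.G0 + Q.G0ᴴ = 0) : Q.ExactlyObservableInFiniteTime T := by
  obtain ⟨M, N, hM, hN, hMH, hNH⟩ := Q.exists_contDiffOn_hamiltonian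
  have hP : ContinuousOn (fun ζ => act (M ζ)) (Icc 0 1) := (contDiffOn_act hM).continuousOn
  have hK := contDiffOn_act hN
  have hPH : ∀ᵐ ζ ∂unitMeasure, act (Q.H ζ) = act (M ζ) := hMH.mono fun ζ h => by rw [h]
  have hKH : ∀ᵐ ζ ∂unitMeasure, act (Q.H ζ)⁻¹ = act (N ζ) := hNH.mono fun ζ h => by rw [h]
  obtain ⟨R, C, hR, hC, hmult⟩ := exists_multiplier hP hPH hK hKH
  obtain ⟨c, hc, hbd⟩ := exists_boundary_le_output hWBC
  obtain ⟨k, hk0, hk⟩ : ∃ k > 0, ∀ ζ ∈ Icc (0 : ℝ) 1, ‖act (N ζ)‖ ≤ k := by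
    obtain ⟨k, hk⟩ := isCompact_Icc.exists_bound_of_continuousOn hK.continuousOn
    exact ⟨max k 1, by positivity, fun ζ hζ => (hk ζ hζ).trans (le_max_left _ _)⟩
  have hkN : ∀ᵐ ζ ∂unitMeasure, ‖act (Q.H ζ)⁻¹‖ ≤ k := by
    filter_upwards [hKH, ae_restrict_mem measurableSet_Icc] with ζ h hζ
    exact h ▸ hk ζ hζ
  set Pop := mulOp _ hP with hPop
  have hPsym : ∀ x y, inner ℂ (Pop x) y = inner ℂ x (Pop y) := by
    refine mulOp_inner_left hP ?_
    filter_upwards [hPH, Q.H_pos] with ζ h1 h2 u v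
    rw [← h1, inner_act_left, h2.isHermitian.eq]
  set c₃ : ℝ := ‖R‖ * k with hc₃
  have hc₃0 : 0 ≤ c₃ := by positivity
  set c₁ : ℝ := ‖act Q.P1‖ * c with hc₁
  set τ : ℝ := 2 * c₃ + 1 with hτ
  have hτ0 : 0 ≤ τ := by positivity
  set D : ℝ := C * c + c₁ * τ + c₁ * c₃ with hD
  have hD0 : 0 ≤ D := by positivity
  refine ⟨τ, by positivity, 1 / (D + 1), by positivity, fun x hx => ?_⟩
  have hsub : Icc 0 τ ⊆ Ici (0 : ℝ) := Icc_subset_Ici_self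
  have hYc : ContinuousOn (fun t => ‖Q.output (T.op t x)‖ ^ 2) (Icc 0 τ) :=
    ((continuousOn_output hP hPH hgen ⟨x, hx⟩).mono hsub).norm.pow 2
  refine ⟨hYc.intervalIntegrable_of_Icc hτ0, ?_⟩
  have o1 := (T.continuousOn_orbit x).mono hsub
  have o2 := (T.continuousOn_orbit (Q.A ⟨x, hx⟩)).mono hsub
  have oP := Pop.continuous.comp_continuousOn o1
  have oR := R.continuous.comp_continuousOn o1
  -- the orbit as a path in the domain, with its image under `A`
  have hz (t : ℝ) (ht : t ∈ Icc 0 τ) : ∃ z : Q.domain, (z : StateSpace n) = T.op t x ∧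
      Q.A z = T.op t (Q.A ⟨x, hx⟩) :=
    ⟨⟨T.op t x, hgen.op_mem_domain ht.1 hx⟩, rfl, hgen.apply_op ht.1 ⟨x, hx⟩⟩
  have key := initial_energy_le_integral (E := fun t => (inner ℂ (T.op t x) (Pop (T.op t x))).re)
    (Ψ := fun t => (inner ℂ (T.op t x) (R (T.op t x))).re)
    (Y := fun t => ‖Q.output (T.op t x)‖ ^ 2)
    (e := fun t => 2 * (inner ℂ (Pop (T.op t x)) (T.op t (Q.A ⟨x, hx⟩))).re)
    (ψ := fun t => 2 * (inner ℂ (R (T.op t x)) (T.op t (Q.A ⟨x, hx⟩))).re)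
    (τ := τ) (c₁ := c₁) (c₂ := C * c) (c₃ := c₃) hτ0 (by positivity) hc₃0
    (fun t ht => by
      have := hgen.re_inner_sub_eq_integral hPsym ⟨x, hx⟩ ht.1
      simpa [T.op_zero] using this)
    (by
      have := hgen.re_inner_sub_eq_integral hR ⟨x, hx⟩ hτ0
      simpa [T.op_zero] using this)
    (fun t ht => by
      obtain ⟨z, e1, e2⟩ := hz t ht
      have hq (v : Vec n) : |(inner ℂ v (act Q.P1 v)).re| ≤ ‖act Q.P1‖ * ‖v‖ ^ 2 := by
        calc |(inner ℂ v (act Q.P1 v)).re| ≤ ‖v‖ * ‖act Q.P1 v‖ :=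
              (Complex.abs_re_le_norm _).trans (norm_inner_le_norm _ _)
          _ ≤ ‖v‖ * (‖act Q.P1‖ * ‖v‖) := by
            gcongr
            exact (act Q.P1).le_opNorm v
          _ = ‖act Q.P1‖ * ‖v‖ ^ 2 := by ring
      simp only [← e1, ← e2, hPop]
      rw [energy_balance hP hPH hG z]
      calc _ ≤ ‖act Q.P1‖ * ‖Q.effort z 1‖ ^ 2 + ‖act Q.P1‖ * ‖Q.effort z 0‖ ^ 2 :=
            (abs_sub _ _).trans (add_le_add (hq _) (hq _))
        _ = ‖act Q.P1‖ * (‖Q.effort z 1‖ ^ 2 + ‖Q.effort z 0‖ ^ 2) := by ring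
        _ ≤ ‖act Q.P1‖ * (c * ‖Q.output (z : StateSpace n)‖ ^ 2) := by
          gcongr
          exact hbd z
        _ = _ := by rw [hc₁, mul_assoc])
    (fun t ht => by
      obtain ⟨z, e1, e2⟩ := hz t ht
      simp only [← e1, ← e2]
      refine (hmult z).trans ?_
      rw [mul_assoc]
      gcongr
      exact hbd z)
    (fun t _ => by
      calc _ ≤ ‖T.op t x‖ * ‖R (T.op t x)‖ :=
            (Complex.abs_re_le_norm _).trans (norm_inner_le_norm _ _)
        _ ≤ ‖T.op t x‖ * (‖R‖ * ‖T.op t x‖) := by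
          gcongr
          exact R.le_opNorm _
        _ = ‖R‖ * ‖T.op t x‖ ^ 2 := by ring
        _ ≤ ‖R‖ * (k * (inner ℂ (T.op t x) (Pop (T.op t x))).re) := by
          gcongr
          exact norm_sq_le_energy hP hPH hk0 hkN _
        _ = _ := by rw [hc₃, mul_assoc])
    (fun t => by positivity) hYc
    (Complex.continuous_re.comp_continuousOn (o1.inner oP))
    ((Complex.continuous_re.comp_continuousOn (oP.inner o2)).const_mul 2)
    ((Complex.continuous_re.comp_continuousOn (oR.inner o2)).const_mul 2)
  have e0 : T.op 0 x = x := by rw [T.op_zero]; rfl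
  simp only [e0] at key
  rw [energyNorm_sq hP hPH, ← hPop, one_div, inv_mul_le_iff₀ (by positivity)]
  have hY : 0 ≤ ∫ t in (0 : ℝ)..τ, ‖Q.output (T.op t x)‖ ^ 2 :=
    intervalIntegral.integral_nonneg hτ0 fun t _ => by positivity
  have h1 : τ - 2 * c₃ = 1 := by rw [hτ]; ring
  rw [h1, one_mul] at key
  exact key.trans (mul_le_mul_of_nonneg_right (by linarith) hY)

end PortHamiltonianSystem

theorem theorem3p2 {n : ℕ} (Q : PortHamiltonianSystem n) (T : C0Semigroup (PortHam.StateSpace n))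
    (hgen : T.IsGenerator Q.A)
    (hWBC : IsUnit Q.WBC)
    (hstable : T.StronglyStable)
    (hG0 : (1 / 2 : ℂ) • (Q.G0 + Q.G0ᴴ) = 0) :
    Q.ExactlyObservableInFiniteTime T := by
  exact PortHamiltonianSystem.exactlyObservableInFiniteTime hgen hWBC
    ((smul_eq_zero.1 hG0).resolve_left (by norm_num))
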